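/- **Setting.** Fix an effectively presented signature $\Theta$ of function symbols with arities, always containing $0,1$ (arity $0$) and $+,\dot-$ (arity $2$, addition and truncated subtraction). *Index terms* are $$I,J,K ::= a \mid f(I_1,\dots,I_k)\mid \textstyle\sum_{a<I}J \mid \mathrm{fc}_a(I,J,K),$$ where $a$ is bound in $J$ in the bounded sum and in $K$ in the forest cardinality. Given partial functions over $\mathbb N$ for the symbols of $\Theta$ (the usual ones for $0,1,+,\dot-$) and an assignment of naturals to the variables, an index term has a possibly undefined value. Function application is strict; a bounded sum is defined when its bound and all its summands are; and $\mathrm{fc}_a(I,J,K)$ is the number of nodes of the forest of $J$ trees, numbered in pre-order from $I$, whose node $v$ has $K\{v/a\}$ children, i.e. it is generated by $\mathrm{fc}_a(I,0,K)=0$ and $\mathrm{fc}_a(I,J+1,K)=x+1+\mathrm{fc}_a(I+1+x,\,K\{I+x/a\},\,K)$ with $x=\mathrm{fc}_a(I,J,K)$. An *equational program* $\mathcal E$ is a set of equations between index terms that determines the meaning of the function symbols: the equations, read as "both sides undefined, or defined and equal", have a least model, and this meaning is partial recursive uniformly in the symbol. $\mathcal E$ is *universal* if for every partial recursive $f:\mathbb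 N^k\rightharpoonup\mathbb N$ there is an index term with free variables among $a_1,\dots,a_k$ whose value is $f(a_1,\dots,a_k)$. A constraint $I\le J$ is true under an assignment if both sides are defined and the inequality holds; $\phi;\Phi\models I\le J$ means that every assignment to the variables $\phi$ making all constraints in $\Phi$ true makes $I\le J$ true, and $\models I=J$ means $\models I\le J$ and $\models J\le I$. *Terms* are $x\mid \underline n\mid\lambda x.t\mid \mathsf{fix}\,x.t\mid tu\mid \mathsf s(t)\mid\mathsf p(t)\mid \mathsf{ifz}\ t\ \mathsf{then}\ u\ \mathsf{else}\ s$. *Linear types* are $A,B::=\sigma\multimap\tau$ and *modal types* are $\sigma,\tau::=[a<I]\,A\mid \mathsf{Nat}[I,J]$, with $a$ bound in $A$. *Subtyping* $\phi;\Phi\vdash\sigma\sqsubseteq\tau$ is generated by: $\mathsf{Nat}[I,J]\sqsubseteq\mathsf{Nat}[K,H]$ if $K\le I$ and $J\le H$; $\sigma\multimap\tau\sqsubseteq\sigma'\multimap\tau'$ if $\sigma'\sqsubseteq\sigma$ and $\tau\sqsubseteq\tau'$; $[a<I]A\sqsubseteq[a<J]B$ if $J\le I$ and $A\sqsubseteq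 B$ under the additional constraint $a<J$. Write $\sigma\equiv\tau$ if $\sigma\sqsubseteq\tau$ and $\tau\sqsubseteq\sigma$. Sums of types are given by $[a<I]A\{a/c\}\uplus[b<J]A\{I+b/c\}=[c<I+J]A$, $\ \sum_{a<I}[b<J]A\{b+\sum_{d<a}J\{d/a\}/c\}=[c<\sum_{a<I}J]A$, $\ \mathsf{Nat}[I,J]\uplus\mathsf{Nat}[I,J]=\mathsf{Nat}[I,J]$ and $\sum_{a<I}\mathsf{Nat}[J,K]=\mathsf{Nat}[J,K]$ ($a$ not free in $J,K$); they extend pointwise to contexts, with $\uplus$ the union on variables that occur in only one of the two contexts. A *derivation* of $\phi;\Phi;\Gamma\vdash_K t:\tau$ ($K$ is the *weight*) is a tree built by these rules ($\phi;\Phi$ is omitted where it does not change): - (Ax) $\Gamma,x:\sigma\vdash_0x:\sigma$. - (Subs) from $\Gamma\vdash_I t:\sigma$, $\Delta\sqsubseteq\Gamma$, $\sigma\sqsubseteq\tau$, $I\le J$ infer $\Delta\vdash_Jt:\tau$. - ($\multimap$) from $(a,\phi);(a<I,\Phi);\Gamma,x:\sigma\vdash_Kt:\tau$ infer $\sum_{a<I}\Gamma\vdash_{I+\sum_{a<I}K}\lambda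 x.t:[a<I](\sigma\multimap\tau)$. - (App) from $\Gamma\vdash_Kt:[a<1](\sigma\multimap\tau)$ and $\Delta\vdash_Hu:\sigma\{0/a\}$ infer $\Gamma\uplus\Delta\vdash_{K+H}tu:\tau\{0/a\}$. - (If) from $\Gamma\vdash_Mt:\mathsf{Nat}[J,K]$, $\ (J\le0,\Phi);\Delta\vdash_Nu:\tau$ and $(K\ge1,\Phi);\Delta\vdash_Ns:\tau$ infer $\Gamma\uplus\Delta\vdash_{M+N}\mathsf{ifz}\ t\ \mathsf{then}\ u\ \mathsf{else}\ s:\tau$. - ($n$) $\Gamma\vdash_0\underline n:\mathsf{Nat}[n,n]$. - ($s$), ($p$) from $\Gamma\vdash_Mt:\mathsf{Nat}[I,J]$ infer $\Gamma\vdash_M\mathsf s(t):\mathsf{Nat}[I+1,J+1]$ and $\Gamma\vdash_M\mathsf p(t):\mathsf{Nat}[I\dot-1,J\dot-1]$. - (Fix) with $H=\mathrm{fc}_b(0,K,I)$: from $(b,\phi);(b<H,\Phi);\Gamma,x:[a<I]A\vdash_Jt:[a<1]B$ and $(a,b,\phi);(a<I,b<H,\Phi)\vdash B\{0/a\}\{\mathrm{fc}_b(b+1,a,I)+b+1/b\}\sqsubseteq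 A$ infer $\sum_{b<H}\Gamma\vdash_{H+\sum_{b<H}J}\mathsf{fix}\,x.t:[a<K]\,B\{0/a\}\{\mathrm{fc}_b(0,a,I)/b\}$. A derivation is *well defined* if in each of its judgements the weight and all index terms in the type and in the context types are defined under the constraints in force where they stand (those of $\Phi$, together with $a<I$ inside $[a<I]A$). Its *skeleton* is the PCF type derivation obtained by erasing all index information; instances of (Subs) disappear. **Proposition (Uniformisation of type derivations).** Let $\mathcal E$ be universal, let $t$ be a closed term, and let $(\pi_n)_{n\in\mathbb N}$ be well-defined derivations of $\emptyset;\emptyset;\emptyset\vdash_{I_n}t:\sigma_n$ such that (a Gödel number of) $\pi_n$ can be computed from $n$ and such that all the $\pi_n$ have the same skeleton. Then there are an index term $I$ and a modal type $\sigma$, with no free index variable other than $a$, and a well-defined derivation of $a;\emptyset;\emptyset\vdash_I t:\sigma$, such that for all $n\in\mathbb N$ $$\models I\{n/a\}=I_n\qquad\text{and}\qquad\models\sigma\{n/a\}\equiv\sigma_n .$$ -/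

import Mathlib

universe u

namespace DlPCF

/-! ## Index terms

Index variables are de Bruijn indices: an object of type `X S n` has its free index variables
among `n` variables, so that `n` plays the role of the set of index variables of a judgement.
Entering the scope of a binder adds the new variable as variable `0`. -/

/-- An (effectively presented) signature: the function symbols other than `0`, `1`, `+`
and truncated subtraction, which are part of every signature and built into `Index`. -/
structure Signature where
  Sym : Type u
  [codable : Primcodable Sym]
  arity : Sym → ℕ

attribute [instance] Signature.codable

inductive Index (S : Signature.{u}) : ℕ → Type u
  | var {n : ℕ} (i : Fin n) : Index S n
  | zero {n : ℕ} : Index S n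
  | one {n : ℕ} : Index S n
  | add {n : ℕ} (I J : Index S n) : Index S n
  | monus {n : ℕ} (I J : Index S n) : Index S n
  | fn {n : ℕ} (f : S.Sym) (args : Fin (S.arity f) → Index S n) : Index S n
  /-- the bounded sum `∑_{a < I} J`, binding `a` in `J` -/
  | bsum {n : ℕ} (I : Index S n) (J : Index S (n + 1)) : Index S n
  /-- the forest cardinality with first node `I`, `J` trees, and children described by `K`,
  in which the node variable is bound -/
  | fcard {n : ℕ} (I J : Index S n) (K : Index S (n + 1)) : Index S n

variable {S : Signature.{u}}

def liftRen {n m : ℕ} (f : Fin n → Fin m) : Fin (n + 1) → Fin (m + 1) :=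
  Fin.cases 0 (fun i => (f i).succ)

namespace Index

def rename : {n m : ℕ} → (Fin n → Fin m) → Index S n → Index S m
  | _, _, f, var i => var (f i)
  | _, _, _, zero => zero
  | _, _, _, one => one
  | _, _, f, add I J => add (I.rename f) (J.rename f)
  | _, _, f, monus I J => monus (I.rename f) (J.rename f)
  | _, _, f, fn g args => fn g (fun i => (args i).rename f)
  | _, _, f, bsum I J => bsum (I.rename f) (J.rename (liftRen f))
  | _, _, f, fcard I J K => fcard (I.rename f) (J.rename f) (K.rename (liftRen f))

/-- Weakening by a fresh innermost variable. -/
def wk {n : ℕ} (I : Index S n) : Index S (n + 1) := I.rename Fin.succ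

def liftSub {n m : ℕ} (s : Fin n → Index S m) : Fin (n + 1) → Index S (m + 1) :=
  Fin.cases (var 0) (fun i => (s i).wk)

/-- Capture-avoiding simultaneous substitution. -/
def subst : {n m : ℕ} → (Fin n → Index S m) → Index S n → Index S m
  | _, _, s, var i => s i
  | _, _, _, zero => zero
  | _, _, _, one => one
  | _, _, s, add I J => add (I.subst s) (J.subst s)
  | _, _, s, monus I J => monus (I.subst s) (J.subst s)
  | _, _, s, fn g args => fn g (fun i => (args i).subst s)
  | _, _, s, bsum I J => bsum (I.subst s) (J.subst (liftSub s))
  | _, _, s, fcard I J K => fcard (I.subst s) (J.subst s) (K.subst (liftSub s))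

/-- The substitution replacing variable `0` by `J` and leaving the others unchanged. -/
def single {n : ℕ} (J : Index S n) : Fin (n + 1) → Index S n :=
  Fin.cases J var

/-- `I{J/a}`, where `a` is variable `0` of `I`. -/
def inst {n : ℕ} (I : Index S (n + 1)) (J : Index S n) : Index S n := I.subst (single J)

/-- The index term `1 + ⋯ + 1` denoting a natural number. -/
def numeral {n : ℕ} : ℕ → Index S n
  | 0 => zero
  | 1 => one
  | k + 2 => add (numeral (k + 1)) one

end Index

/-! ## Meaning of index terms -/

/-- An interpretation of the function symbols as partial functions over the naturals. -/
abbrev Interp (S : Signature.{u}) : Type u :=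
  (f : S.Sym) → (Fin (S.arity f) → ℕ) → Part ℕ

/-- A tuple of partial values is defined when all its components are. -/
def tuple {k : ℕ} (v : Fin k → Part ℕ) : Part (Fin k → ℕ) :=
  ⟨∀ i, (v i).Dom, fun h i => (v i).get (h i)⟩

/-- `partialSum g m = g 0 + ⋯ + g (m - 1)`, defined when all summands are. -/
def partialSum (g : ℕ → Part ℕ) : ℕ → Part ℕ
  | 0 => Part.some 0
  | m + 1 => (partialSum g m).bind fun x => (g m).map fun y => x + y

/-- `Forest κ i j x`: the forest of `j` trees whose nodes are numbered in pre-order starting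
from `i`, and in which node `v` has `κ v` children, is finite and has `x` nodes. -/
inductive Forest (κ : ℕ → Part ℕ) : ℕ → ℕ → ℕ → Prop
  | zero (i : ℕ) : Forest κ i 0 0
  | succ {i j x c y : ℕ} (h₁ : Forest κ i j x) (hc : c ∈ κ (i + x))
      (h₂ : Forest κ (i + 1 + x) c y) : Forest κ i (j + 1) (x + 1 + y)

theorem Forest.unique {κ : ℕ → Part ℕ} {i j x x' : ℕ} (h : Forest κ i j x)
    (h' : Forest κ i j x') : x = x' := by
  induction h generalizing x' with
  | zero i => cases h'; rfl
  | succ h₁ hc h₂ ih₁ ih₂ =>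
    cases h' with
    | succ g₁ gc g₂ =>
      obtain rfl := ih₁ g₁
      obtain rfl := Part.mem_unique hc gc
      obtain rfl := ih₂ g₂
      rfl

noncomputable def forestCard (κ : ℕ → Part ℕ) (i j : ℕ) : Part ℕ :=
  ⟨∃ x, Forest κ i j x, fun h => h.choose⟩

theorem mem_forestCard {κ : ℕ → Part ℕ} {i j x : ℕ} :
    x ∈ forestCard κ i j ↔ Forest κ i j x := by
  constructor
  · rintro ⟨h, rfl⟩
    exact h.choose_spec
  · intro h
    exact ⟨⟨x, h⟩, (Exists.choose_spec (⟨x, h⟩ : ∃ x, Forest κ i j x)).unique h⟩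

/-- The (possibly undefined) value of an index term under an assignment. -/
noncomputable def Index.eval (φ : Interp S) : {n : ℕ} → Index S n → (Fin n → ℕ) → Part ℕ
  | _, var i, ρ => Part.some (ρ i)
  | _, zero, _ => Part.some 0
  | _, one, _ => Part.some 1
  | _, add I J, ρ => (I.eval φ ρ).bind fun x => (J.eval φ ρ).map fun y => x + y
  | _, monus I J, ρ => (I.eval φ ρ).bind fun x => (J.eval φ ρ).map fun y => x - y
  | _, fn f args, ρ => (tuple fun i => (args i).eval φ ρ).bind (φ f)
  | _, bsum I J, ρ =>
      (I.eval φ ρ).bind fun m => partialSum (fun a => J.eval φ (Fin.cons a ρ)) m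
  | _, fcard I J K, ρ =>
      (I.eval φ ρ).bind fun i => (J.eval φ ρ).bind fun j =>
        forestCard (fun a => K.eval φ (Fin.cons a ρ)) i j

/-! ## Equational programs -/

/-- An equation between index terms, in finitely many (universally quantified) variables. -/
structure Equation (S : Signature.{u}) where
  vars : ℕ
  lhs : Index S vars
  rhs : Index S vars

/-- `φ` satisfies the equations: both sides are undefined, or defined and equal. -/
def Interp.Models (φ : Interp S) (eqs : Set (Equation S)) : Prop :=
  ∀ e ∈ eqs, ∀ ρ : Fin e.vars → ℕ, e.lhs.eval φ ρ = e.rhs.eval φ ρ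

/-- An equational program: a set of equations which determines the meaning of every function
symbol. This meaning is the least model of the equations (with respect to inclusion of graphs);
if there is a unique model, then it is the least one. Since the equations are a program, the
meaning of the function symbols is computed, uniformly, by some algorithm. -/
structure EqProgram (S : Signature.{u}) where
  eqs : Set (Equation S)
  interp : Interp S
  least : IsLeast {φ : Interp S | φ.Models eqs} interp
  effective : ∃ U : S.Sym × List ℕ →. ℕ, Partrec U ∧
    ∀ (f : S.Sym) (args : Fin (S.arity f) → ℕ), U (f, List.ofFn args) = interp f args

/-- Every partial recursive function is expressible by an index term. -/
def EqProgram.Universal (E : EqProgram S) : Prop :=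
  ∀ (k : ℕ) (f : List.Vector ℕ k →. ℕ), Partrec f →
    ∃ I : Index S k, ∀ ρ : Fin k → ℕ, I.eval E.interp ρ = f (List.Vector.ofFn ρ)

/-! ## Constraints -/

/-- The constraint `lhs ≤ rhs`. -/
structure Constraint (S : Signature.{u}) (n : ℕ) where
  lhs : Index S n
  rhs : Index S n

/-- Index contexts, i.e. finite collections of constraints. -/
abbrev ICtx (S : Signature.{u}) (n : ℕ) : Type u := List (Constraint S n)

def ICtx.wk {n : ℕ} (Φ : ICtx S n) : ICtx S (n + 1) :=
  Φ.map fun c => ⟨c.lhs.wk, c.rhs.wk⟩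

/-- `(a < I, Φ)` over the index variables extended by `a`. -/
def ICtx.below {n : ℕ} (I : Index S n) (Φ : ICtx S n) : ICtx S (n + 1) :=
  ⟨.add (.var 0) .one, I.wk⟩ :: Φ.wk

/-- A constraint is true when both sides are defined and the inequality holds. -/
def Constraint.True (E : EqProgram S) {n : ℕ} (c : Constraint S n) (ρ : Fin n → ℕ) : Prop :=
  ∃ x ∈ c.lhs.eval E.interp ρ, ∃ y ∈ c.rhs.eval E.interp ρ, x ≤ y

/-- `Φ ⊨ I ≤ J` -/
def Le (E : EqProgram S) {n : ℕ} (Φ : ICtx S n) (I J : Index S n) : Prop :=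
  ∀ ρ : Fin n → ℕ, (∀ c ∈ Φ, c.True E ρ) → Constraint.True E ⟨I, J⟩ ρ

/-- `Φ ⊨ I = J`; in particular both sides are defined. -/
def Eqv (E : EqProgram S) {n : ℕ} (Φ : ICtx S n) (I J : Index S n) : Prop :=
  Le E Φ I J ∧ Le E Φ J I

/-- `Φ ⊨ I ⇓` -/
def Def (E : EqProgram S) {n : ℕ} (Φ : ICtx S n) (I : Index S n) : Prop := Le E Φ I I

/-! ## Types -/

/-- Modal types. `bang I σ τ` is `[a < I] (σ ⊸ τ)`, which binds `a` in `σ` and in `τ`;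
`nat I J` is the type of the natural numbers between `I` and `J`. -/
inductive ModTy (S : Signature.{u}) : ℕ → Type u
  | nat {n : ℕ} (I J : Index S n) : ModTy S n
  | bang {n : ℕ} (I : Index S n) (σ τ : ModTy S (n + 1)) : ModTy S n

/-- Linear types `dom ⊸ cod`. -/
structure LinTy (S : Signature.{u}) (n : ℕ) where
  dom : ModTy S n
  cod : ModTy S n

namespace ModTy

def rename : {n m : ℕ} → (Fin n → Fin m) → ModTy S n → ModTy S m
  | _, _, f, nat I J => nat (I.rename f) (J.rename f)
  | _, _, f, bang I σ τ => bang (I.rename f) (σ.rename (liftRen f)) (τ.rename (liftRen f))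

def wk {n : ℕ} (σ : ModTy S n) : ModTy S (n + 1) := σ.rename Fin.succ

def subst : {n m : ℕ} → (Fin n → Index S m) → ModTy S n → ModTy S m
  | _, _, s, nat I J => nat (I.subst s) (J.subst s)
  | _, _, s, bang I σ τ =>
      bang (I.subst s) (σ.subst (Index.liftSub s)) (τ.subst (Index.liftSub s))

def inst {n : ℕ} (σ : ModTy S (n + 1)) (J : Index S n) : ModTy S n :=
  σ.subst (Index.single J)

/-- `[a < I] A` -/
def modal {n : ℕ} (I : Index S n) (A : LinTy S (n + 1)) : ModTy S n := bang I A.dom A.cod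

end ModTy

namespace LinTy

def subst {n m : ℕ} (s : Fin n → Index S m) (A : LinTy S n) : LinTy S m :=
  ⟨A.dom.subst s, A.cod.subst s⟩

def inst {n : ℕ} (A : LinTy S (n + 1)) (J : Index S n) : LinTy S n :=
  A.subst (Index.single J)

end LinTy

/-- The sum of modal types, as a (functional) relation: `[a < I] A{a/c}` and
`[b < J] A{I + b/c}` have the sum `[c < I + J] A`. -/
inductive Sum : {n : ℕ} → ModTy S n → ModTy S n → ModTy S n → Prop
  | nat {n : ℕ} (I J : Index S n) : Sum (.nat I J) (.nat I J) (.nat I J)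
  | modal {n : ℕ} (I J : Index S n) (A : LinTy S (n + 1)) :
      Sum (.modal I A)
        (.modal J (A.subst (Fin.cases (.add I.wk (.var 0)) fun i => .var i.succ)))
        (.modal (.add I J) A)

/-- The bounded sum `∑_{a < I} σ = τ`, where `a` is variable `0` of `σ`:
`∑_{a < I} [b < J] A{b + ∑_{d < a} J{d/a} / c}` is `[c < ∑_{a < I} J] A`. -/
inductive BSum : {n : ℕ} → Index S n → ModTy S (n + 1) → ModTy S n → Prop
  | nat {n : ℕ} (I J K : Index S n) : BSum I (.nat J.wk K.wk) (.nat J K)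
  | modal {n : ℕ} (I : Index S n) (J : Index S (n + 1)) (A : LinTy S (n + 1)) :
      BSum I
        (.modal J (A.subst (Fin.cases
          (.add (.var 0)
            (.bsum (.var 1) (J.rename (Fin.cases 0 fun i => i.succ.succ.succ))))
          fun i => .var i.succ.succ)))
        (.modal (.bsum I J) A)

/-- Subtyping of modal types. -/
inductive Sub (E : EqProgram S) : {n : ℕ} → ICtx S n → ModTy S n → ModTy S n → Prop
  | nat {n : ℕ} {Φ : ICtx S n} {I J K H : Index S n} (h₁ : Le E Φ K I) (h₂ : Le E Φ J H) :
      Sub E Φ (.nat I J) (.nat K H)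
  | bang {n : ℕ} {Φ : ICtx S n} {I J : Index S n} {σ τ σ' τ' : ModTy S (n + 1)}
      (hdom : Sub E (Φ.below J) σ' σ) (hcod : Sub E (Φ.below J) τ τ') (h : Le E Φ J I) :
      Sub E Φ (.bang I σ τ) (.bang J σ' τ')

/-- Subtyping of linear types. -/
def SubLin (E : EqProgram S) {n : ℕ} (Φ : ICtx S n) (A B : LinTy S n) : Prop :=
  Sub E Φ B.dom A.dom ∧ Sub E Φ A.cod B.cod

/-- Equivalence of modal types: subtyping in both directions. -/
def TyEqv (E : EqProgram S) {n : ℕ} (Φ : ICtx S n) (σ τ : ModTy S n) : Prop :=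
  Sub E Φ σ τ ∧ Sub E Φ τ σ

/-- All index terms of a type are defined, under the constraints in force where they stand. -/
def ModTy.Def (E : EqProgram S) : {n : ℕ} → ICtx S n → ModTy S n → Prop
  | _, Φ, .nat I J => DlPCF.Def E Φ I ∧ DlPCF.Def E Φ J
  | _, Φ, .bang I σ τ => DlPCF.Def E Φ I ∧ σ.Def E (Φ.below I) ∧ τ.Def E (Φ.below I)

/-! ## Terms and contexts -/

/-- Terms whose free variables are among `k` variables (de Bruijn). -/
inductive Term : ℕ → Type
  | var {k : ℕ} (x : Fin k) : Term k
  | num {k : ℕ} (m : ℕ) : Term k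
  | lam {k : ℕ} (t : Term (k + 1)) : Term k
  | fix {k : ℕ} (t : Term (k + 1)) : Term k
  | app {k : ℕ} (t u : Term k) : Term k
  | succ {k : ℕ} (t : Term k) : Term k
  | pred {k : ℕ} (t : Term k) : Term k
  | ifz {k : ℕ} (t u s : Term k) : Term k

/-- Typing contexts: finite partial maps from term variables to modal types. -/
abbrev Ctx (S : Signature.{u}) (k n : ℕ) : Type u := Fin k → Option (ModTy S n)

/-- `Γ, x : σ`, with `x` the new variable `0`. -/
def Ctx.snoc {k n : ℕ} (Γ : Ctx S k n) (σ : ModTy S n) : Ctx S (k + 1) n :=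
  Fin.cons (some σ) Γ

def Ctx.empty {k n : ℕ} : Ctx S k n := fun _ => none

/-- The sum of contexts is the sum of types on common variables and the union elsewhere. -/
inductive SumOpt {n : ℕ} :
    Option (ModTy S n) → Option (ModTy S n) → Option (ModTy S n) → Prop
  | none : SumOpt none none none
  | left (σ : ModTy S n) : SumOpt (some σ) none (some σ)
  | right (σ : ModTy S n) : SumOpt none (some σ) (some σ)
  | both {σ τ υ : ModTy S n} (h : Sum σ τ υ) : SumOpt (some σ) (some τ) (some υ)

def Ctx.Sum {k n : ℕ} (Γ Δ Ξ : Ctx S k n) : Prop := ∀ x, SumOpt (Γ x) (Δ x) (Ξ x)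

/-- `∑_{a < I} Γ = Δ` -/
def Ctx.BSum {k n : ℕ} (I : Index S n) (Γ : Ctx S k (n + 1)) (Δ : Ctx S k n) : Prop :=
  ∀ x, Option.Rel (DlPCF.BSum I) (Γ x) (Δ x)

def Ctx.Sub (E : EqProgram S) {k n : ℕ} (Φ : ICtx S n) (Δ Γ : Ctx S k n) : Prop :=
  ∀ x, Option.Rel (DlPCF.Sub E Φ) (Δ x) (Γ x)

/-! ## Type derivations -/

/-- `Deriv E Φ Γ K t τ` is the type of all derivations of the judgement `Φ; Γ ⊢_K t : τ`. -/
inductive Deriv (E : EqProgram S) : {k n : ℕ} → ICtx S n → Ctx S k n → Index S n →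
    Term k → ModTy S n → Type u
  | ax {k n : ℕ} {Φ : ICtx S n} {Γ : Ctx S k n} {x : Fin k} {σ : ModTy S n}
      (h : Γ x = some σ) :
      Deriv E Φ Γ .zero (.var x) σ
  | subs {k n : ℕ} {Φ : ICtx S n} {Γ Δ : Ctx S k n} {I J : Index S n} {t : Term k}
      {σ τ : ModTy S n}
      (d : Deriv E Φ Γ I t σ) (hctx : Ctx.Sub E Φ Δ Γ) (hty : Sub E Φ σ τ) (hw : Le E Φ I J) :
      Deriv E Φ Δ J t τ
  | lam {k n : ℕ} {Φ : ICtx S n} {I : Index S n} {Γ : Ctx S k (n + 1)} {Δ : Ctx S k n}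
      {K : Index S (n + 1)} {t : Term (k + 1)} {σ τ : ModTy S (n + 1)}
      (d : Deriv E (Φ.below I) (Γ.snoc σ) K t τ) (hΔ : Ctx.BSum I Γ Δ) :
      Deriv E Φ Δ (.add I (.bsum I K)) (.lam t) (.bang I σ τ)
  | app {k n : ℕ} {Φ : ICtx S n} {Γ Δ Ξ : Ctx S k n} {K H : Index S n} {t u : Term k}
      {σ τ : ModTy S (n + 1)}
      (d : Deriv E Φ Γ K t (.bang .one σ τ)) (e : Deriv E Φ Δ H u (σ.inst .zero))
      (hΞ : Ctx.Sum Γ Δ Ξ) :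
      Deriv E Φ Ξ (.add K H) (.app t u) (τ.inst .zero)
  | ifz {k n : ℕ} {Φ : ICtx S n} {Γ Δ Ξ : Ctx S k n} {M N J K : Index S n} {t u s : Term k}
      {τ : ModTy S n}
      (d : Deriv E Φ Γ M t (.nat J K))
      (e₀ : Deriv E (⟨J, .zero⟩ :: Φ) Δ N u τ)
      (e₁ : Deriv E (⟨.one, K⟩ :: Φ) Δ N s τ)
      (hΞ : Ctx.Sum Γ Δ Ξ) :
      Deriv E Φ Ξ (.add M N) (.ifz t u s) τ
  | num {k n : ℕ} {Φ : ICtx S n} {Γ : Ctx S k n} (m : ℕ) :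
      Deriv E Φ Γ .zero (.num m) (.nat (.numeral m) (.numeral m))
  | succ {k n : ℕ} {Φ : ICtx S n} {Γ : Ctx S k n} {M I J : Index S n} {t : Term k}
      (d : Deriv E Φ Γ M t (.nat I J)) :
      Deriv E Φ Γ M (.succ t) (.nat (.add I .one) (.add J .one))
  | pred {k n : ℕ} {Φ : ICtx S n} {Γ : Ctx S k n} {M I J : Index S n} {t : Term k}
      (d : Deriv E Φ Γ M t (.nat I J)) :
      Deriv E Φ Γ M (.pred t) (.nat (.monus I .one) (.monus J .one))
  /-- The variable `b` is variable `0` of `Γ`, `I` and `J`; in `A` and `B` the variables `0`, `1`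
  are `a`, `b`. Here `H` is the forest cardinality with first node `0`, `K` trees and children
  described by `I`. -/
  | fix {k n : ℕ} {Φ : ICtx S n} {Γ : Ctx S k (n + 1)} {Δ : Ctx S k n} {K H : Index S n}
      {I J : Index S (n + 1)} {t : Term (k + 1)} {A B : LinTy S (n + 2)}
      (hH : H = .fcard .zero K I)
      (d : Deriv E (Φ.below H) (Γ.snoc (.modal I A)) J t (.modal .one B))
      (hsub : SubLin E ((Φ.below H).below I)
        ((B.inst .zero).subst (Fin.cases
          (.add
            (.add
              (.fcard (.add (.var 1) .one) (.var 0)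
                (I.rename (Fin.cases 0 fun i => i.succ.succ.succ)))
              (.var 1))
            .one)
          fun i => .var i.succ.succ))
        A)
      (hΔ : Ctx.BSum H Γ Δ) :
      Deriv E Φ Δ (.add H (.bsum H J)) (.fix t)
        (.modal K ((B.inst .zero).subst (Fin.cases
          (.fcard .zero (.var 0) (I.rename (Fin.cases 0 fun i => i.succ.succ)))
          fun i => .var i.succ)))

/-! ## Definedness of a derivation -/

/-- The context types, the weight and the type of the judgement are defined under `Φ`. -/
def Deriv.JudgDef {E : EqProgram S} {k n : ℕ} {Φ : ICtx S n} {Γ : Ctx S k n} {K : Index S n}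
    {t : Term k} {τ : ModTy S n} (_ : Deriv E Φ Γ K t τ) : Prop :=
  (∀ x, ∀ σ ∈ Γ x, σ.Def E Φ) ∧ Def E Φ K ∧ τ.Def E Φ

/-- All the judgements of the derivation are defined. -/
def Deriv.WellDefined {E : EqProgram S} : {k n : ℕ} → {Φ : ICtx S n} → {Γ : Ctx S k n} →
    {K : Index S n} → {t : Term k} → {τ : ModTy S n} → Deriv E Φ Γ K t τ → Prop
  | _, _, _, _, _, _, _, d@(.ax _) => d.JudgDef
  | _, _, _, _, _, _, _, d@(.subs d₁ _ _ _) => d.JudgDef ∧ d₁.WellDefined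
  | _, _, _, _, _, _, _, d@(.lam d₁ _) => d.JudgDef ∧ d₁.WellDefined
  | _, _, _, _, _, _, _, d@(.app d₁ d₂ _) => d.JudgDef ∧ d₁.WellDefined ∧ d₂.WellDefined
  | _, _, _, _, _, _, _, d@(.ifz d₁ d₂ d₃ _) =>
      d.JudgDef ∧ d₁.WellDefined ∧ d₂.WellDefined ∧ d₃.WellDefined
  | _, _, _, _, _, _, _, d@(.num _) => d.JudgDef
  | _, _, _, _, _, _, _, d@(.succ d₁) => d.JudgDef ∧ d₁.WellDefined
  | _, _, _, _, _, _, _, d@(.pred d₁) => d.JudgDef ∧ d₁.WellDefined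
  | _, _, _, _, _, _, _, d@(.fix _ d₁ _ _) => d.JudgDef ∧ d₁.WellDefined

/-! ## Skeletons -/

/-- PCF types. -/
inductive PTy : Type
  | nat : PTy
  | arr (α β : PTy) : PTy

/-- Erasure of all index information from a modal type. -/
def ModTy.erase : {n : ℕ} → ModTy S n → PTy
  | _, .nat _ _ => .nat
  | _, .bang _ σ τ => .arr σ.erase τ.erase

/-- PCF type derivations, as trees of rules labelled with the type of the subject of the
conclusion. The derivations compared below are derivations for one and the same closed term, so
that the subjects need not be repeated; nor need the contexts, because the type of a variable is
read off at its binder. -/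
inductive Skeleton : Type
  | var (α : PTy) : Skeleton
  | num (α : PTy) : Skeleton
  | lam (α : PTy) (d : Skeleton) : Skeleton
  | fix (α : PTy) (d : Skeleton) : Skeleton
  | app (α : PTy) (d e : Skeleton) : Skeleton
  | succ (α : PTy) (d : Skeleton) : Skeleton
  | pred (α : PTy) (d : Skeleton) : Skeleton
  | ifz (α : PTy) (d e₀ e₁ : Skeleton) : Skeleton

/-- The erased type of the subject of a derivation. -/
def Deriv.pty {E : EqProgram S} {k n : ℕ} {Φ : ICtx S n} {Γ : Ctx S k n} {K : Index S n}
    {t : Term k} {τ : ModTy S n} (_ : Deriv E Φ Γ K t τ) : PTy := τ.erase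

/-- The PCF derivation obtained by erasing all index information. Subsumption does not change
erased types, and its instances disappear. -/
def Deriv.skeleton {E : EqProgram S} : {k n : ℕ} → {Φ : ICtx S n} → {Γ : Ctx S k n} →
    {K : Index S n} → {t : Term k} → {τ : ModTy S n} → Deriv E Φ Γ K t τ → Skeleton
  | _, _, _, _, _, _, _, d@(.ax _) => .var d.pty
  | _, _, _, _, _, _, _, .subs d₁ _ _ _ => d₁.skeleton
  | _, _, _, _, _, _, _, d@(.lam d₁ _) => .lam d.pty d₁.skeleton
  | _, _, _, _, _, _, _, d@(.app d₁ d₂ _) => .app d.pty d₁.skeleton d₂.skeleton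
  | _, _, _, _, _, _, _, d@(.ifz d₁ d₂ d₃ _) =>
      .ifz d.pty d₁.skeleton d₂.skeleton d₃.skeleton
  | _, _, _, _, _, _, _, d@(.num _) => .num d.pty
  | _, _, _, _, _, _, _, d@(.succ d₁) => .succ d.pty d₁.skeleton
  | _, _, _, _, _, _, _, d@(.pred d₁) => .pred d.pty d₁.skeleton
  | _, _, _, _, _, _, _, d@(.fix _ d₁ _ _) => .fix d.pty d₁.skeleton

/-! ## Gödel numbers -/

/-- The code of a node with the given label and children. -/
def codeNode (label : ℕ) (children : List ℕ) : ℕ := Encodable.encode (label :: children)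

def Index.code : {n : ℕ} → Index S n → ℕ
  | _, var i => codeNode 0 [i]
  | _, zero => codeNode 1 []
  | _, one => codeNode 2 []
  | _, add I J => codeNode 3 [I.code, J.code]
  | _, monus I J => codeNode 4 [I.code, J.code]
  | _, fn f args => codeNode 5 (Encodable.encode f :: List.ofFn fun i => (args i).code)
  | _, bsum I J => codeNode 6 [I.code, J.code]
  | _, fcard I J K => codeNode 7 [I.code, J.code, K.code]

def ModTy.code : {n : ℕ} → ModTy S n → ℕ
  | _, .nat I J => codeNode 0 [I.code, J.code]
  | _, .bang I σ τ => codeNode 1 [I.code, σ.code, τ.code]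

def Term.code : {k : ℕ} → Term k → ℕ
  | _, .var x => codeNode 0 [x]
  | _, .num m => codeNode 1 [m]
  | _, .lam t => codeNode 2 [t.code]
  | _, .fix t => codeNode 3 [t.code]
  | _, .app t u => codeNode 4 [t.code, u.code]
  | _, .succ t => codeNode 5 [t.code]
  | _, .pred t => codeNode 6 [t.code]
  | _, .ifz t u s => codeNode 7 [t.code, u.code, s.code]

def ICtx.code {n : ℕ} (Φ : ICtx S n) : ℕ :=
  Encodable.encode (Φ.map fun c => codeNode 0 [c.lhs.code, c.rhs.code])

def Ctx.code {k n : ℕ} (Γ : Ctx S k n) : ℕ :=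
  Encodable.encode (List.ofFn fun x => Encodable.encode ((Γ x).map ModTy.code))

/-- The code of a derivation ending with the rule number `rule`, given those of its immediate
subderivations. It contains the whole judgement that is derived. -/
def Deriv.codeStep {E : EqProgram S} {k n : ℕ} {Φ : ICtx S n} {Γ : Ctx S k n} {K : Index S n}
    {t : Term k} {τ : ModTy S n} (_ : Deriv E Φ Γ K t τ) (rule : ℕ) (premises : List ℕ) : ℕ :=
  codeNode rule
    (codeNode 0 [k, n, Φ.code, Γ.code, K.code, t.code, τ.code] :: premises)

/-- The Gödel number of a derivation. -/
def Deriv.code {E : EqProgram S} : {k n : ℕ} → {Φ : ICtx S n} → {Γ : Ctx S k n} →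
    {K : Index S n} → {t : Term k} → {τ : ModTy S n} → Deriv E Φ Γ K t τ → ℕ
  | _, _, _, _, _, _, _, d@(.ax _) => d.codeStep 0 []
  | _, _, _, _, _, _, _, d@(.subs d₁ _ _ _) => d.codeStep 1 [d₁.code]
  | _, _, _, _, _, _, _, d@(.lam d₁ _) => d.codeStep 2 [d₁.code]
  | _, _, _, _, _, _, _, d@(.app d₁ d₂ _) => d.codeStep 3 [d₁.code, d₂.code]
  | _, _, _, _, _, _, _, d@(.ifz d₁ d₂ d₃ _) => d.codeStep 4 [d₁.code, d₂.code, d₃.code]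
  | _, _, _, _, _, _, _, d@(.num _) => d.codeStep 5 []
  | _, _, _, _, _, _, _, d@(.succ d₁) => d.codeStep 6 [d₁.code]
  | _, _, _, _, _, _, _, d@(.pred d₁) => d.codeStep 7 [d₁.code]
  | _, _, _, _, _, _, _, d@(.fix _ d₁ _ _) => d.codeStep 8 [d₁.code]

end DlPCF

namespace DlPCF

variable {S : Signature.{u}} {E : EqProgram S}

/-! ## Bounded sums and forests as iterations and searches -/

/-! The heart of the matter is uniformisation of index terms. The value of an index term is computed
from its code by a partial recursive function (`exists_evaluator`), so if the codes of terms `I n`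
are computable from `n`, then the value of `I n` is partial recursive in `n` and the assignment, and
universality provides a single index term with one more variable having these values
(`EqProgram.Universal.exists_index`). Types with a common erasure are uniformised component by
component (`EqProgram.Universal.exists_type`).

The derivation is then rebuilt by induction on the term. Three obstacles shape the argument.

Equality: uniformised terms agree with the given ones only in value, whereas sums of types and the
conclusions of rules are syntactic. Types are therefore given a pointwise meaning `ETy`, and a
subtyping is valid exactly when it holds pointwise between types of the same erasure (`Sub.den`,
`Sub.of_den`). Uniform types are built in the syntactic form demanded by a rule, and subsumption
bridges the rest.

Subsumption: the derivations of a family may use it at different places and different numbers of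
times. The induction statement `Uniformisable` absorbs it: every judgement weaker than all members
of the family is derivable. Final subsumptions can then be removed, computably on codes
(`Deriv.exists_proper`, `Uniformisable.of_proper`), after which the subject determines the last
rule.

Contexts: they are partial, and a variable may be declared in some members of a family only, or be
shared between two premises in some members only. Only variables declared in all members matter
(`CtxBelow`), and a missing modal type acts as one with bound `0`
(`EqProgram.Universal.exists_sum`).

Equality of skeletons is what gives the types occurring inside the derivations, such as the argument
type of an application, a common erasure. -/

theorem mem_partialSum_succ {g : ℕ → Part ℕ} {m z : ℕ} :
    z ∈ partialSum g (m + 1) ↔ ∃ x ∈ partialSum g m, ∃ y ∈ g m, x + y = z := by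
  simp [partialSum]

theorem partialSum_add {g : ℕ → Part ℕ} {a b s t : ℕ} (hs : s ∈ partialSum g a)
    (ht : t ∈ partialSum (fun v => g (a + v)) b) : s + t ∈ partialSum g (a + b) := by
  induction b generalizing t with
  | zero =>
    obtain rfl : t = 0 := by simpa [partialSum] using ht
    exact hs
  | succ b ih =>
    obtain ⟨x, hx, y, hy, rfl⟩ := mem_partialSum_succ.1 ht
    exact mem_partialSum_succ.2 ⟨s + x, ih hx, y, hy, by omega⟩

theorem partialSum_add_inv {g : ℕ → Part ℕ} {a b s z : ℕ} (hs : s ∈ partialSum g a)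
    (hz : z ∈ partialSum g (a + b)) : ∃ t ∈ partialSum (fun v => g (a + v)) b, s + t = z := by
  induction b generalizing z with
  | zero => exact ⟨0, by simp [partialSum], Part.mem_unique hs hz⟩
  | succ b ih =>
    obtain ⟨x, hx, y, hy, rfl⟩ := mem_partialSum_succ.1 hz
    obtain ⟨t, ht, rfl⟩ := ih hx
    exact ⟨t + y, mem_partialSum_succ.2 ⟨t, ht, y, hy, rfl⟩, by omega⟩

theorem partialSum_dom_of_le {g : ℕ → Part ℕ} {m k : ℕ} (hk : k ≤ m)
    (h : (partialSum g m).Dom) : (partialSum g k).Dom := by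
  induction m with
  | zero =>
    obtain rfl : k = 0 := by omega
    exact h
  | succ m ih =>
    rcases Nat.lt_or_ge k (m + 1) with hlt | hge
    · obtain ⟨z, hz⟩ := Part.dom_iff_mem.1 h
      obtain ⟨x, hx, -⟩ := mem_partialSum_succ.1 hz
      exact ih (by omega) (Part.dom_iff_mem.2 ⟨x, hx⟩)
    · obtain rfl : k = m + 1 := by omega
      exact h

/-- Each node is either one of the `j` roots or a child of exactly one node, hence the equation.
After a proper initial segment of the pre-order, some node already announced as a root or a child is
still to be visited, hence the strict inequality. -/
theorem Forest.exists_sum {κ : ℕ → Part ℕ} {i j x : ℕ} (h : Forest κ i j x) :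
    (∃ s ∈ partialSum (fun v => κ (i + v)) x, j + s = x) ∧
      ∀ m < x, ∃ s ∈ partialSum (fun v => κ (i + v)) m, m < j + s := by
  induction h with
  | zero i => exact ⟨⟨0, by simp [partialSum], rfl⟩, fun m hm => absurd hm (by omega)⟩
  | @succ i j x c y h₁ hc h₂ ih₁ ih₂ =>
    obtain ⟨⟨s, hs, hsx⟩, ih₁⟩ := ih₁
    obtain ⟨⟨t, ht, hty⟩, ih₂⟩ := ih₂
    have hs1 : s + c ∈ partialSum (fun v => κ (i + v)) (x + 1) :=
      mem_partialSum_succ.2 ⟨s, hs, c, hc, rfl⟩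
    have e : (fun v => κ (i + (x + 1 + v))) = fun v => κ (i + 1 + x + v) := by
      funext v; congr 1; omega
    refine ⟨⟨s + c + t, partialSum_add hs1 (e ▸ ht), by omega⟩, fun m hm => ?_⟩
    rcases lt_trichotomy m x with hlt | rfl | hgt
    · obtain ⟨s', hs', hlt'⟩ := ih₁ m hlt
      exact ⟨s', hs', by omega⟩
    · exact ⟨s, hs, by omega⟩
    · obtain ⟨d, rfl⟩ : ∃ d, m = x + 1 + d := ⟨m - (x + 1), by omega⟩
      obtain ⟨s', hs', hlt'⟩ := ih₂ d (by omega)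
      exact ⟨s + c + s', partialSum_add hs1 (e ▸ hs'), by omega⟩

/-- The number of pending nodes, `j + s - m` after `m` visits, decreases by at most one per step, so
it cannot jump over a value. The last tree is split off where the first `j` of the `j + 1` trees are
exhausted, and the two remaining forests are smaller. -/
theorem Forest.of_sum {κ : ℕ → Part ℕ} {x : ℕ} : ∀ {i j : ℕ},
    (∃ s ∈ partialSum (fun v => κ (i + v)) x, j + s = x) →
      (∀ m < x, ∃ s ∈ partialSum (fun v => κ (i + v)) m, j + s ≠ m) → Forest κ i j x := by
  induction x using Nat.strong_induction_on with
  | _ x ih =>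
  rintro i (_ | j) ⟨s, hs, hsx⟩ hlt
  · rcases Nat.eq_zero_or_pos x with rfl | hpos
    · exact .zero i
    · obtain ⟨s', hs', hne⟩ := hlt 0 hpos
      obtain rfl : s' = 0 := by simpa [partialSum] using hs'
      exact absurd rfl hne
  · classical
    -- The least such `m` is the size of the first `j` trees. The bound `≤` suffices for the search;
    -- minimality turns it into an equality.
    have hex : ∃ m, ∃ s ∈ partialSum (fun v => κ (i + v)) m, j + s ≤ m :=
      ⟨x, s, hs, by omega⟩
    obtain ⟨s₁, hs₁, hle⟩ := Nat.find_spec hex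
    have hmin := fun m => Nat.find_min (m := m) hex
    generalize Nat.find hex = x₁ at hs₁ hle hmin
    have hx₁ : j + s₁ = x₁ := by
      rcases x₁ with _ | m
      · omega
      · obtain ⟨s₀, hs₀, y, -, rfl⟩ := mem_partialSum_succ.1 hs₁
        have := hmin m (by omega)
        push Not at this
        have := this s₀ hs₀
        omega
    have hx₁x : x₁ < x := by
      rcases Nat.lt_or_ge x₁ x with h | h
      · exact h
      · rcases Nat.eq_or_lt_of_le h with rfl | h
        · have := Part.mem_unique hs hs₁
          omega
        · exact absurd ⟨s, hs, by omega⟩ (hmin x h)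
    obtain ⟨y, rfl⟩ : ∃ y, x = x₁ + 1 + y := ⟨x - (x₁ + 1), by omega⟩
    have hdom := partialSum_dom_of_le (show x₁ + 1 ≤ x₁ + 1 + y by omega)
      (Part.dom_iff_mem.2 ⟨s, hs⟩)
    obtain ⟨s₂, hs₂⟩ := Part.dom_iff_mem.1 hdom
    -- The node `i + x₁` is the root of the last tree, and `c` is its number of children.
    obtain ⟨s₁', hs₁', c, hc, rfl⟩ := mem_partialSum_succ.1 hs₂
    obtain rfl := Part.mem_unique hs₁ hs₁'
    have e : (fun v => κ (i + (x₁ + 1 + v))) = fun v => κ (i + 1 + x₁ + v) := by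
      funext v; congr 1; omega
    refine .succ (ih x₁ (by omega) ⟨s₁, hs₁, hx₁⟩ fun m hm => ?_) hc
      (ih y (by omega) ?_ fun m hm => ?_)
    · obtain ⟨s', hs', -⟩ := hlt m (by omega)
      refine ⟨s', hs', fun h => hmin m hm ⟨s', hs', h.le⟩⟩
    · obtain ⟨t, ht, rfl⟩ := partialSum_add_inv hs₂ hs
      exact ⟨t, by simpa only [e] using ht, by omega⟩
    · obtain ⟨s', hs', hne⟩ := hlt (x₁ + 1 + m) (by omega)
      obtain ⟨t, ht, rfl⟩ := partialSum_add_inv hs₂ hs'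
      exact ⟨t, by simpa only [e] using ht, by omega⟩

/-- The number of nodes of a forest, found by search: a forest of `j` trees is complete as soon
as it has as many nodes as there are roots and children of its nodes. -/
theorem forestCard_eq_rfind (κ : ℕ → Part ℕ) (i j : ℕ) :
    forestCard κ i j = Nat.rfind fun m =>
      (partialSum (fun v => κ (i + v)) m).map fun s => decide (j + s = m) := by
  ext x
  rw [mem_forestCard]
  refine Iff.trans ?_ Nat.mem_rfind.symm
  constructor
  · intro h
    obtain ⟨⟨s, hs, hx⟩, hlt⟩ := h.exists_sum
    refine ⟨(Part.mem_map_iff _).2 ⟨s, hs, by simpa using hx⟩, fun {m} hm => ?_⟩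
    obtain ⟨s', hs', hlt'⟩ := hlt m hm
    exact (Part.mem_map_iff _).2 ⟨s', hs', by simp; omega⟩
  · rintro ⟨h, hlt⟩
    refine Forest.of_sum ?_ fun m hm => ?_
    · obtain ⟨s, hs, hx⟩ := (Part.mem_map_iff _).1 h
      exact ⟨s, hs, by simpa using hx⟩
    · obtain ⟨s, hs, hx⟩ := (Part.mem_map_iff _).1 (hlt hm)
      exact ⟨s, hs, by simpa using hx⟩

theorem Forest.exists_of_le {κ : ℕ → Part ℕ} {i j x j' : ℕ} (h : Forest κ i j x) (hj : j' ≤ j) :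
    ∃ x', Forest κ i j' x' := by
  induction h generalizing j' with
  | zero i =>
    obtain rfl : j' = 0 := by omega
    exact ⟨0, .zero i⟩
  | @succ i j x c y h₁ hc h₂ ih₁ ih₂ =>
    rcases Nat.eq_or_lt_of_le hj with rfl | hlt
    · exact ⟨_, .succ h₁ hc h₂⟩
    · exact ih₁ (by omega)

/-- Every node of a forest is the root of a tree. -/
theorem Forest.exists_subforest {κ : ℕ → Part ℕ} {i j x v : ℕ} (h : Forest κ i j x)
    (hi : i ≤ v) (hv : v < i + x) : ∃ c ∈ κ v, ∃ y, Forest κ (v + 1) c y := by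
  induction h generalizing v with
  | zero i => omega
  | @succ i j x c y h₁ hc h₂ ih₁ ih₂ =>
    rcases lt_trichotomy v (i + x) with hlt | rfl | hgt
    · exact ih₁ hi hlt
    · exact ⟨c, hc, y, by simpa only [Nat.add_right_comm] using h₂⟩
    · exact ih₂ (by omega) (by omega)

/-! ## Reading codes -/

def fields (c : ℕ) : List ℕ := (Encodable.decode (α := List ℕ) c).getD []

/-- The `i`-th entry of the list coded by `c`. -/
def field (i c : ℕ) : ℕ := (fields c).getD i 0

theorem fields_codeNode (l : ℕ) (cs : List ℕ) : fields (codeNode l cs) = l :: cs := by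
  simp [fields, codeNode]

theorem field_codeNode (i l : ℕ) (cs : List ℕ) :
    field i (codeNode l cs) = (l :: cs).getD i 0 := by
  rw [field, fields_codeNode]

theorem fields_encode (cs : List ℕ) : fields (Encodable.encode cs) = cs := by
  simp [fields]

theorem primrec_fields : Primrec fields :=
  Primrec.option_getD.comp (Primrec.decode (α := List ℕ)) (Primrec.const [])

theorem primrec₂_field : Primrec₂ field :=
  (Primrec.list_getD 0).comp (primrec_fields.comp Primrec.snd) Primrec.fst

theorem computable_field {α : Type*} [Primcodable α] {f : α → ℕ} (i : ℕ) (hf : Computable f) :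
    Computable fun a => field i (f a) :=
  primrec₂_field.to_comp.comp (Computable.const i) hf

/-! ## A partial recursive evaluator -/

/-- The list of the values `g 0, …, g (m - 1)`. -/
def collect (g : ℕ → Part ℕ) : ℕ → Part (List ℕ)
  | 0 => Part.some []
  | m + 1 => (collect g m).bind fun l => (g m).map fun y => l ++ [y]

/-- Arguments of function symbols come as tuples of dependent length, which are not inputs of a
partial recursive function. Lists built by primitive recursion replace them. -/
theorem collect_eq_tuple (g : ℕ → Part ℕ) (k : ℕ) :
    collect g k = (tuple fun i : Fin k => g i).map List.ofFn := by
  ext l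
  simp only [Part.mem_map_iff]
  induction k generalizing l with
  | zero =>
    simp only [collect, Part.mem_some_iff, List.ofFn_zero]
    constructor
    · rintro rfl
      exact ⟨fun i => i.elim0, ⟨fun i => i.elim0, funext fun i => i.elim0⟩, rfl⟩
    · rintro ⟨_, _, rfl⟩; rfl
  | succ k ih =>
    simp only [collect, Part.mem_bind_iff, Part.mem_map_iff, ih]
    constructor
    · rintro ⟨_, ⟨v, ⟨hv, rfl⟩, rfl⟩, y, ⟨hy, rfl⟩, rfl⟩
      refine ⟨_, ⟨fun i => ?_, rfl⟩, ?_⟩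
      · refine Fin.lastCases ?_ (fun i => ?_) i
        · exact hy
        · exact hv i
      · rw [List.ofFn_succ', List.concat_eq_append]
        simp [tuple]
    · rintro ⟨v, ⟨hv, rfl⟩, rfl⟩
      refine ⟨_, ⟨_, ⟨fun i => hv i.castSucc, rfl⟩, rfl⟩, _, ⟨hv (Fin.last k), rfl⟩, ?_⟩
      rw [List.ofFn_succ', List.concat_eq_append]
      simp [tuple]

theorem partrec_partialSum {α : Type*} [Primcodable α] {g : α → ℕ →. ℕ} {m : α → ℕ}
    (hg : Partrec₂ g) (hm : Computable m) : Partrec fun a => partialSum (g a) (m a) := by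
  have h : Partrec₂ fun (a : α) (p : ℕ × ℕ) => (g a p.1).map fun y => p.2 + y :=
    Partrec.map (hg.comp Computable.fst (Computable.fst.comp Computable.snd))
      (Primrec.nat_add.to_comp.comp ((Computable.snd.comp Computable.snd).comp Computable.fst)
        Computable.snd)
  refine (Partrec.nat_rec hm (Computable.const 0).partrec h).of_eq fun a => ?_
  induction m a with
  | zero => rfl
  | succ k ih => simp only [ih]; rfl

theorem partrec_collect {α : Type*} [Primcodable α] {g : α → ℕ →. ℕ} {m : α → ℕ}
    (hg : Partrec₂ g) (hm : Computable m) : Partrec fun a => collect (g a) (m a) := by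
  have h : Partrec₂ fun (a : α) (p : ℕ × List ℕ) => (g a p.1).map fun y => p.2 ++ [y] :=
    Partrec.map (hg.comp Computable.fst (Computable.fst.comp Computable.snd))
      (Primrec.list_concat.to_comp.comp
        ((Computable.snd.comp Computable.snd).comp Computable.fst) Computable.snd)
  refine (Partrec.nat_rec hm (Computable.const ([] : List ℕ)).partrec h).of_eq fun a => ?_
  induction m a with
  | zero => rfl
  | succ k ih => simp only [ih]; rfl

theorem partrec_forestCard {α : Type*} [Primcodable α] {κ : α → ℕ →. ℕ} {i j : α → ℕ}
    (hκ : Partrec₂ κ) (hi : Computable i) (hj : Computable j) :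
    Partrec fun a => forestCard (κ a) (i a) (j a) := by
  have hs : Partrec₂ fun (a : α) (m : ℕ) => partialSum (fun v => κ a (i a + v)) m := by
    refine partrec_partialSum (g := fun (p : α × ℕ) v => κ p.1 (i p.1 + v)) ?_ Computable.snd
    exact hκ.comp (Computable.fst.comp Computable.fst)
      (Primrec.nat_add.to_comp.comp (hi.comp (Computable.fst.comp Computable.fst))
        Computable.snd)
  have hp : Partrec₂ fun (a : α) (m : ℕ) =>
      (partialSum (fun v => κ a (i a + v)) m).map fun s => decide (j a + s = m) := by
    refine Partrec.map hs (?_ : Computable _)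
    exact (Primrec.eq (α := ℕ)).decide.to_comp.comp
      (Primrec.nat_add.to_comp.comp (hj.comp (Computable.fst.comp Computable.fst))
        Computable.snd) (Computable.snd.comp Computable.fst)
  exact (Partrec.rfind hp).of_eq fun a => (forestCard_eq_rfind _ _ _).symm

/-- One step of the evaluation of the index term with a given code, in terms of an evaluator `ev`
of the codes of its subterms. -/
noncomputable def evalStep (U : ℕ → List ℕ →. ℕ) (ev : ℕ → List ℕ →. ℕ) (c : ℕ) (ρ : List ℕ) :
    Part ℕ :=
  bif decide (field 0 c = 0) then Part.some (ρ.getD (field 1 c) 0) else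
  bif decide (field 0 c = 1) then Part.some 0 else
  bif decide (field 0 c = 2) then Part.some 1 else
  bif decide (field 0 c = 3) then
    (ev (field 1 c) ρ).bind fun x => (ev (field 2 c) ρ).map fun y => x + y else
  bif decide (field 0 c = 4) then
    (ev (field 1 c) ρ).bind fun x => (ev (field 2 c) ρ).map fun y => x - y else
  bif decide (field 0 c = 5) then
    (collect (fun i => ev (field (i + 2) c) ρ) ((fields c).length - 2)).bind
      fun l => U (field 1 c) l else
  bif decide (field 0 c = 6) then
    (ev (field 1 c) ρ).bind fun m => partialSum (fun a => ev (field 2 c) (a :: ρ)) m else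
  (ev (field 1 c) ρ).bind fun i => (ev (field 2 c) ρ).bind fun j =>
    forestCard (fun a => ev (field 3 c) (a :: ρ)) i j

theorem partrec_evalStep {α : Type*} [Primcodable α] {U : ℕ → List ℕ →. ℕ} (hU : Partrec₂ U)
    {ev : α → ℕ → List ℕ →. ℕ} (hev : Partrec fun p : α × ℕ × List ℕ => ev p.1 p.2.1 p.2.2)
    {c : α → ℕ} {ρ : α → List ℕ} (hc : Computable c) (hρ : Computable ρ) :
    Partrec fun a => evalStep U (ev a) (c a) (ρ a) := by
  have test (i : ℕ) : Computable fun a => decide (field 0 (c a) = i) :=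
    (Primrec.eq (α := ℕ)).decide.to_comp.comp (computable_field 0 hc) (Computable.const i)
  have sub {β : Type _} [Primcodable β] {a : β → α} {d : β → ℕ} {r : β → List ℕ}
      (ha : Computable a) (hd : Computable d) (hr : Computable r) :
      Partrec fun b => ev (a b) (d b) (r b) := hev.comp (ha.pair (hd.pair hr))
  have sub₀ (i : ℕ) : Partrec fun a => ev a (field i (c a)) (ρ a) :=
    sub Computable.id (computable_field i hc) hρ
  have bin {f : ℕ → ℕ → ℕ} (hf : Primrec₂ f) : Partrec fun a =>
      (ev a (field 1 (c a)) (ρ a)).bind fun x =>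
        (ev a (field 2 (c a)) (ρ a)).map fun y => f x y :=
    (sub₀ 1).bind (Partrec.map ((sub₀ 2).comp Computable.fst)
      (hf.to_comp.comp (Computable.snd.comp Computable.fst) Computable.snd))
  have under {β : Type _} [Primcodable β] {a : β → α} (ha : Computable a) (i : ℕ) :
      Partrec₂ fun (b : β) (x : ℕ) => ev (a b) (field i (c (a b))) (x :: ρ (a b)) := by
    have ha' : Computable fun b : β × ℕ => a b.1 := ha.comp Computable.fst
    have hr : Computable fun b : β × ℕ => b.2 :: ρ (a b.1) :=
      Computable.list_cons.comp Computable.snd (hρ.comp ha')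
    exact sub (β := β × ℕ) ha' (computable_field i (hc.comp ha')) hr
  refine Partrec.cond (test 0) ?_ (Partrec.cond (test 1) ?_ (Partrec.cond (test 2) ?_
    (Partrec.cond (test 3) ?_ (Partrec.cond (test 4) ?_ (Partrec.cond (test 5) ?_
      (Partrec.cond (test 6) ?_ ?_))))))
  · exact ((Primrec.list_getD 0).to_comp.comp hρ (computable_field 1 hc)).partrec
  · exact (Computable.const 0).partrec
  · exact (Computable.const 1).partrec
  · exact bin Primrec.nat_add
  · exact bin Primrec.nat_sub
  · refine Partrec.bind (partrec_collect
      (g := fun a i => ev a (field (i + 2) (c a)) (ρ a)) ?_ ?_) ?_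
    · refine sub Computable.fst ?_ (hρ.comp Computable.fst)
      exact primrec₂_field.to_comp.comp
        (Primrec.nat_add.to_comp.comp Computable.snd (Computable.const 2))
        (hc.comp Computable.fst)
    · exact Primrec.nat_sub.to_comp.comp
        (Primrec.list_length.to_comp.comp (primrec_fields.to_comp.comp hc))
        (Computable.const 2)
    · exact hU.comp (computable_field 1 (hc.comp Computable.fst)) Computable.snd
  · exact (sub₀ 1).bind (partrec_partialSum (under Computable.fst 2) Computable.snd)
  · refine (sub₀ 1).bind (Partrec.bind ((sub₀ 2).comp Computable.fst) ?_)
    exact partrec_forestCard (under (Computable.fst.comp Computable.fst) 3)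
      (Computable.snd.comp Computable.fst) Computable.snd

/-- Any solution `ev` of the recursion equation is correct on codes, by induction on the index term;
its behaviour on other numbers is irrelevant. The list `l` may be longer than the assignment that it
represents. -/
theorem evalStep_code (E : EqProgram S) {U : ℕ → List ℕ →. ℕ} {ev : ℕ → List ℕ →. ℕ}
    (hU : ∀ (f : S.Sym) (args : Fin (S.arity f) → ℕ),
      U (Encodable.encode f) (List.ofFn args) = E.interp f args)
    (hev : ∀ c ρ, ev c ρ = evalStep U ev c ρ) {n : ℕ} (I : Index S n) (ρ : Fin n → ℕ)
    (l : List ℕ) (hl : ∀ i : Fin n, l.getD i 0 = ρ i) : ev I.code l = I.eval E.interp ρ := by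
  have hcons {n : ℕ} {ρ : Fin n → ℕ} {l : List ℕ} (hl : ∀ i : Fin n, l.getD i 0 = ρ i) (a : ℕ) :
      ∀ i : Fin (n + 1), (a :: l).getD i 0 = (Fin.cons a ρ : Fin (n + 1) → ℕ) i :=
    Fin.cases rfl fun i => by simpa using hl i
  induction I generalizing l with
  | var i => rw [hev]; simpa [evalStep, Index.code, Index.eval, field_codeNode] using hl i
  | zero => rw [hev]; simp [evalStep, Index.code, Index.eval, field_codeNode]
  | one => rw [hev]; simp [evalStep, Index.code, Index.eval, field_codeNode]
  | add I J ihI ihJ =>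
    rw [hev]
    simp [evalStep, Index.code, Index.eval, field_codeNode, ihI _ _ hl, ihJ _ _ hl]
  | monus I J ihI ihJ =>
    rw [hev]
    simp [evalStep, Index.code, Index.eval, field_codeNode, ihI _ _ hl, ihJ _ _ hl]
  | fn f args ih =>
    rw [hev]
    have e : collect (fun i => ev ((5 :: Encodable.encode f ::
        List.ofFn fun i => (args i).code).getD (i + 2) 0) l) (S.arity f) =
        (tuple fun i => (args i).eval E.interp ρ).map List.ofFn := by
      rw [collect_eq_tuple]
      congr 2
      funext i
      rw [← ih i ρ l hl]
      simp
    -- The arity is recovered from the code: the label and the symbol precede the arguments.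
    have hlen : (5 :: Encodable.encode f :: List.ofFn fun i => (args i).code).length - 2 =
        S.arity f := by simp
    have hstep : evalStep U ev (Index.fn f args).code l =
        ((tuple fun i => (args i).eval E.interp ρ).map List.ofFn).bind
          fun l => U (Encodable.encode f) l := by
      rw [← (congrArg (collect _) hlen).trans e]
      simp only [evalStep, Index.code, field_codeNode, fields_codeNode]
      rfl
    rw [hstep, Part.bind_map]
    simp only [hU]
    rfl
  | bsum I J ihI ihJ =>
    rw [hev]
    simp [evalStep, Index.code, Index.eval, field_codeNode, ihI _ _ hl,
      fun a => ihJ _ _ (hcons hl a)]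
  | fcard I J K ihI ihJ ihK =>
    rw [hev]
    simp [evalStep, Index.code, Index.eval, field_codeNode, ihI _ _ hl, ihJ _ _ hl,
      fun a => ihK _ _ (hcons hl a)]

/-- The values of index terms are computed from their codes by a partial recursive function. -/
theorem exists_evaluator (E : EqProgram S) : ∃ ev : ℕ → List ℕ →. ℕ, Partrec₂ ev ∧
    ∀ {n : ℕ} (I : Index S n) (ρ : Fin n → ℕ) (l : List ℕ),
      (∀ i : Fin n, l.getD i 0 = ρ i) → ev I.code l = I.eval E.interp ρ := by
  obtain ⟨U, hU, hUE⟩ := E.effective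
  let U' : ℕ → List ℕ →. ℕ := fun c l =>
    (Part.ofOption (Encodable.decode (α := S.Sym) c)).bind fun f => U (f, l)
  have hU' : Partrec₂ U' := by
    refine Partrec.bind (Computable.ofOption (Computable.decode.comp Computable.fst)) ?_
    exact hU.comp (Computable.snd.pair (Computable.snd.comp Computable.fst))
  -- The recursive calls of the evaluator are made through a program `e` for it, which Kleene's
  -- recursion theorem supplies below.
  let run : Nat.Partrec.Code → ℕ → List ℕ →. ℕ := fun e c l =>
    e.eval (Nat.pair c (Encodable.encode l))
  have hrun : Partrec fun p : Nat.Partrec.Code × ℕ × List ℕ => run p.1 p.2.1 p.2.2 :=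
    Nat.Partrec.Code.eval_part.comp Computable.fst
      (Primrec₂.natPair.to_comp.comp (Computable.fst.comp Computable.snd)
        (Computable.encode.comp (Computable.snd.comp Computable.snd)))
  have hstep : Partrec₂ fun (e : Nat.Partrec.Code) (x : ℕ) =>
      evalStep U' (run e) x.unpair.1 (fields x.unpair.2) :=
    partrec_evalStep (α := Nat.Partrec.Code × ℕ) (ev := fun p => run p.1)
      (c := fun p => p.2.unpair.1) (ρ := fun p => fields p.2.unpair.2) hU'
      (hrun.comp ((Computable.fst.comp Computable.fst).pair Computable.snd))
      (Computable.fst.comp (Primrec.unpair.to_comp.comp Computable.snd))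
      (primrec_fields.to_comp.comp
        (Computable.snd.comp (Primrec.unpair.to_comp.comp Computable.snd)))
  obtain ⟨e, he⟩ := Nat.Partrec.Code.fixed_point₂ hstep
  refine ⟨run e, hrun.comp ((Computable.const e).pair Computable.id), ?_⟩
  refine fun I ρ l hl => evalStep_code E (U := U') (fun f args => ?_) (fun c ρ => ?_) I ρ l hl
  · simp [U', hUE]
  · change e.eval _ = _
    rw [he]
    simp [fields_encode]

/-! ## Uniformisation of index terms -/

/-- The assignment `ρ` extended by the value `n` of a last variable. -/
def push {p : ℕ} (ρ : Fin p → ℕ) (n : ℕ) : Fin (p + 1) → ℕ := Fin.snoc (α := fun _ => ℕ) ρ n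

/-- Binders add variable `0`, whereas the index of the family is the last variable. The two
extensions commute, so passing under a binder needs no renaming. -/
theorem cons_push {p : ℕ} (a : ℕ) (ρ : Fin p → ℕ) (n : ℕ) :
    (Fin.cons a (push ρ n) : Fin (p + 2) → ℕ) = push (Fin.cons a ρ) n :=
  Fin.cons_snoc_eq_snoc_cons (β := ℕ) a ρ n

theorem exists_push {p : ℕ} (ρ : Fin (p + 1) → ℕ) : ∃ ρ' n, ρ = push ρ' n :=
  ⟨Fin.init ρ, ρ (Fin.last p), (Fin.snoc_init_self ρ).symm⟩

/-- The function taking an assignment and `n` to the value of `I n` is partial recursive, by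
composing the evaluator with the computation of codes. The equality includes definedness on both
sides. -/
theorem EqProgram.Universal.exists_index {E : EqProgram S} (hE : E.Universal) {p : ℕ}
    {I : ℕ → Index S p} (hI : Computable fun n => (I n).code) :
    ∃ I' : Index S (p + 1), ∀ ρ n,
      I'.eval E.interp (push ρ n) = (I n).eval E.interp ρ := by
  obtain ⟨ev, hev, hcode⟩ := exists_evaluator E
  obtain ⟨I', hI'⟩ := hE (p + 1) (fun v => ev (I (v.get (Fin.last p))).code v.toList)
    (hev.comp (hI.comp (Primrec.vector_get.to_comp.comp Computable.id
      (Computable.const (Fin.last p)))) Primrec.vector_toList.to_comp)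
  refine ⟨I', fun ρ n => ?_⟩
  rw [hI']
  have : (List.Vector.ofFn (push ρ n)).get (Fin.last p) = n := by simp [push]
  simp only [this]
  -- The whole vector, including its last entry `n`, is passed as the assignment; `I n` reads only
  -- the first `p` entries.
  refine hcode _ _ _ fun i => ?_
  rw [List.Vector.toList_ofFn, List.getD_eq_getElem?_getD, List.getElem?_ofFn]
  have h : (i : ℕ) < p + 1 := by omega
  simp only [h, dif_pos, Option.getD_some]
  exact Fin.snoc_castSucc (α := fun _ => ℕ) n ρ i

/-! ## Renaming and substitution in index terms -/

theorem cons_liftRen {n m : ℕ} (f : Fin n → Fin m) (a : ℕ) (ρ : Fin m → ℕ) :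
    (fun i => (Fin.cons a ρ : Fin (m + 1) → ℕ) (liftRen f i)) =
      (Fin.cons a fun i => ρ (f i) : Fin (n + 1) → ℕ) :=
  funext (Fin.cases rfl fun _ => rfl)

theorem Index.eval_rename (φ : Interp S) {n m : ℕ} (f : Fin n → Fin m) (I : Index S n)
    (ρ : Fin m → ℕ) : (I.rename f).eval φ ρ = I.eval φ fun i => ρ (f i) := by
  induction I generalizing m with
  | var i => rfl
  | zero => rfl
  | one => rfl
  | add I J ihI ihJ => simp only [rename, eval, ihI, ihJ]
  | monus I J ihI ihJ => simp only [rename, eval, ihI, ihJ]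
  | fn g args ih => simp only [rename, eval, ih]
  | bsum I J ihI ihJ => simp only [rename, eval, ihI, ihJ, cons_liftRen]
  | fcard I J K ihI ihJ ihK => simp only [rename, eval, ihI, ihJ, ihK, cons_liftRen]

theorem Index.eval_wk (φ : Interp S) {n : ℕ} (I : Index S n) (a : ℕ) (ρ : Fin n → ℕ) :
    I.wk.eval φ (Fin.cons a ρ) = I.eval φ ρ :=
  I.eval_rename φ Fin.succ _

/-- The substitution `s` transforms the assignment `ρ` into `ρ'`. -/
def Transforms (φ : Interp S) {n m : ℕ} (s : Fin n → Index S m) (ρ : Fin m → ℕ)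
    (ρ' : Fin n → ℕ) : Prop :=
  ∀ i, (s i).eval φ ρ = Part.some (ρ' i)

theorem Transforms.lift {φ : Interp S} {n m : ℕ} {s : Fin n → Index S m} {ρ : Fin m → ℕ}
    {ρ' : Fin n → ℕ} (h : Transforms φ s ρ ρ') (a : ℕ) :
    Transforms φ (Index.liftSub s) (Fin.cons a ρ) (Fin.cons a ρ') :=
  Fin.cases rfl fun i => (Index.eval_wk φ (s i) a ρ).trans (h i)

/-- `Transforms` demands that the substituted terms be defined. This is why definedness of partial
sums and finiteness of forests have to be established before types are substituted into. -/
theorem Index.eval_subst {φ : Interp S} {n m : ℕ} {s : Fin n → Index S m} (I : Index S n)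
    {ρ : Fin m → ℕ} {ρ' : Fin n → ℕ} (h : Transforms φ s ρ ρ') :
    (I.subst s).eval φ ρ = I.eval φ ρ' := by
  induction I generalizing m with
  | var i => exact h i
  | zero => rfl
  | one => rfl
  | add I J ihI ihJ => simp only [subst, eval, ihI h, ihJ h]
  | monus I J ihI ihJ => simp only [subst, eval, ihI h, ihJ h]
  | fn g args ih => simp only [subst, eval, ih _ h]
  | bsum I J ihI ihJ => simp only [subst, eval, ihI h, fun a => ihJ (h.lift a)]
  | fcard I J K ihI ihJ ihK =>
    simp only [subst, eval, ihI h, ihJ h, fun a => ihK (h.lift a)]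

theorem transforms_single {φ : Interp S} {n : ℕ} {J : Index S n} {ρ : Fin n → ℕ} {j : ℕ}
    (h : J.eval φ ρ = Part.some j) : Transforms φ (Index.single J) ρ (Fin.cons j ρ) :=
  Fin.cases h fun _ => rfl

theorem Index.eval_numeral (φ : Interp S) {n : ℕ} (k : ℕ) (ρ : Fin n → ℕ) :
    (numeral k : Index S n).eval φ ρ = Part.some k := by
  induction k using Nat.strong_induction_on with
  | _ k ih =>
    match k with
    | 0 => rfl
    | 1 => rfl
    | k + 2 =>
      rw [numeral, eval, ih (k + 1) (by omega)]
      simp [eval]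

/-! ## Truth of constraints -/

def PLe (x y : Part ℕ) : Prop := ∃ a ∈ x, ∃ b ∈ y, a ≤ b

def PLt (a : ℕ) (y : Part ℕ) : Prop := ∃ m ∈ y, a < m

theorem PLe.refl {x : Part ℕ} (h : x.Dom) : PLe x x :=
  ⟨x.get h, Part.get_mem h, x.get h, Part.get_mem h, le_rfl⟩

theorem PLe.trans {x y z : Part ℕ} (h : PLe x y) (h' : PLe y z) : PLe x z := by
  obtain ⟨a, ha, b, hb, hab⟩ := h
  obtain ⟨b', hb', c, hc, hbc⟩ := h'
  obtain rfl := Part.mem_unique hb hb'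
  exact ⟨a, ha, c, hc, hab.trans hbc⟩

theorem PLe.dom_left {x y : Part ℕ} (h : PLe x y) : x.Dom := by
  obtain ⟨a, ha, -⟩ := h
  exact Part.dom_iff_mem.2 ⟨a, ha⟩

theorem PLe.dom_right {x y : Part ℕ} (h : PLe x y) : y.Dom := by
  obtain ⟨-, -, b, hb, -⟩ := h
  exact Part.dom_iff_mem.2 ⟨b, hb⟩

theorem PLt.trans_le {a : ℕ} {x y : Part ℕ} (h : PLt a x) (h' : PLe x y) : PLt a y := by
  obtain ⟨m, hm, ham⟩ := h
  obtain ⟨m', hm', b, hb, hmb⟩ := h'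
  obtain rfl := Part.mem_unique hm hm'
  exact ⟨b, hb, by omega⟩

theorem zero_PLe {x : Part ℕ} (h : x.Dom) : PLe (Part.some 0) x :=
  ⟨0, Part.mem_some 0, x.get h, Part.get_mem h, Nat.zero_le _⟩

theorem not_PLt_zero {a : ℕ} : ¬ PLt a (Part.some 0) := by
  rintro ⟨m, hm, h⟩
  rw [Part.mem_some_iff] at hm
  omega

/-- All constraints of `Φ` are true. -/
def Holds (E : EqProgram S) {n : ℕ} (Φ : ICtx S n) (ρ : Fin n → ℕ) : Prop :=
  ∀ c ∈ Φ, c.True E ρ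

theorem holds_nil {n : ℕ} (ρ : Fin n → ℕ) : Holds E [] ρ := fun _ h => by simp at h

theorem holds_cons {n : ℕ} {I J : Index S n} {Φ : ICtx S n} {ρ : Fin n → ℕ} :
    Holds E (⟨I, J⟩ :: Φ) ρ ↔
      PLe (I.eval E.interp ρ) (J.eval E.interp ρ) ∧ Holds E Φ ρ :=
  List.forall_mem_cons

theorem holds_below {n : ℕ} {I : Index S n} {Φ : ICtx S n} {a : ℕ} {ρ : Fin n → ℕ} :
    Holds E (Φ.below I) (Fin.cons a ρ) ↔ PLt a (I.eval E.interp ρ) ∧ Holds E Φ ρ := by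
  rw [ICtx.below, holds_cons, Index.eval_wk]
  refine and_congr ?_ ?_
  · simp [PLe, PLt, Index.eval]
  · simp only [Holds, ICtx.wk, List.forall_mem_map]
    refine forall₂_congr fun c _ => ?_
    simp only [Constraint.True, Index.eval_wk]

theorem holds_below_push {n p : ℕ} {I : Index S (p + 1)} {Φ : ICtx S (p + 1)} {a : ℕ}
    {ρ : Fin p → ℕ} : Holds E (Φ.below I) (push (Fin.cons a ρ) n) ↔
      PLt a (I.eval E.interp (push ρ n)) ∧ Holds E Φ (push ρ n) := by
  rw [← cons_push, holds_below]

theorem def_iff {n : ℕ} {Φ : ICtx S n} {I : Index S n} :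
    Def E Φ I ↔ ∀ ρ, Holds E Φ ρ → (I.eval E.interp ρ).Dom :=
  forall₂_congr fun _ _ => ⟨PLe.dom_left, PLe.refl⟩

/-! ## Pointwise meaning of types -/

/-- The meaning of a modal type under an assignment. -/
inductive ETy : Type
  | nat (I J : Part ℕ) : ETy
  | bang (I : Part ℕ) (σ τ : ℕ → ETy) : ETy

inductive ESub : ETy → ETy → Prop
  | nat {I J K H : Part ℕ} (h₁ : PLe K I) (h₂ : PLe J H) : ESub (.nat I J) (.nat K H)
  | bang {I J : Part ℕ} {σ τ σ' τ' : ℕ → ETy} (hdom : ∀ a, PLt a J → ESub (σ' a) (σ a))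
      (hcod : ∀ a, PLt a J → ESub (τ a) (τ' a)) (h : PLe J I) :
      ESub (.bang I σ τ) (.bang J σ' τ')

def ETy.Def : ETy → Prop
  | nat I J => I.Dom ∧ J.Dom
  | bang I σ τ => I.Dom ∧ ∀ a, PLt a I → (σ a).Def ∧ (τ a).Def

theorem ESub.refl {X : ETy} (h : X.Def) : ESub X X := by
  induction X with
  | nat I J => exact .nat (.refl h.1) (.refl h.2)
  | bang I σ τ ihσ ihτ =>
    exact .bang (fun a ha => ihσ a (h.2 a ha).1) (fun a ha => ihτ a (h.2 a ha).2) (.refl h.1)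

/-- The induction is on the middle type, because contravariance exchanges the outer two. -/
theorem ESub.trans {X Y Z : ETy} (h : ESub X Y) (h' : ESub Y Z) : ESub X Z := by
  induction Y generalizing X Z with
  | nat I J =>
    cases h with | nat h₁ h₂ =>
    cases h' with | nat h₁' h₂' =>
    exact .nat (h₁'.trans h₁) (h₂.trans h₂')
  | bang I σ τ ihσ ihτ =>
    cases h with | bang hd hc h =>
    cases h' with | bang hd' hc' h' =>
    exact .bang (fun a ha => ihσ a (hd' a ha) (hd a (ha.trans_le h')))
      (fun a ha => ihτ a (hc a (ha.trans_le h')) (hc' a ha)) (h'.trans h)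

noncomputable def ModTy.den (φ : Interp S) : {n : ℕ} → ModTy S n → (Fin n → ℕ) → ETy
  | _, nat I J, ρ => .nat (I.eval φ ρ) (J.eval φ ρ)
  | _, bang I σ τ, ρ =>
      .bang (I.eval φ ρ) (fun a => σ.den φ (Fin.cons a ρ)) fun a => τ.den φ (Fin.cons a ρ)

theorem ModTy.def_iff {n : ℕ} {Φ : ICtx S n} {σ : ModTy S n} :
    σ.Def E Φ ↔ ∀ ρ, Holds E Φ ρ → (σ.den E.interp ρ).Def := by
  induction σ with
  | nat I J =>
    simp only [ModTy.Def, DlPCF.def_iff, den, ETy.Def]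
    exact ⟨fun h ρ hρ => ⟨h.1 ρ hρ, h.2 ρ hρ⟩, fun h => ⟨fun ρ hρ => (h ρ hρ).1,
      fun ρ hρ => (h ρ hρ).2⟩⟩
  | bang I σ τ ihσ ihτ =>
    simp only [ModTy.Def, DlPCF.def_iff, den, ETy.Def, ihσ, ihτ]
    constructor
    · rintro ⟨h, hσ, hτ⟩ ρ hρ
      exact ⟨h ρ hρ, fun a ha => ⟨hσ _ (holds_below.2 ⟨ha, hρ⟩), hτ _ (holds_below.2 ⟨ha, hρ⟩)⟩⟩
    · intro h
      refine ⟨fun ρ hρ => (h ρ hρ).1, fun ρ => ?_, fun ρ => ?_⟩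
      · induction ρ using Fin.consCases with | _ a ρ =>
        intro hρ
        have hρ := holds_below.1 hρ
        exact ((h ρ hρ.2).2 a hρ.1).1
      · induction ρ using Fin.consCases with | _ a ρ =>
        intro hρ
        have hρ := holds_below.1 hρ
        exact ((h ρ hρ.2).2 a hρ.1).2

theorem Sub.erase_eq {n : ℕ} {Φ : ICtx S n} {σ τ : ModTy S n} (h : Sub E Φ σ τ) :
    σ.erase = τ.erase := by
  induction h with
  | nat h₁ h₂ => rfl
  | bang hdom hcod h ihd ihc => simp only [ModTy.erase, ihd, ihc]

theorem Sub.den {n : ℕ} {Φ : ICtx S n} {σ τ : ModTy S n} (h : Sub E Φ σ τ) {ρ : Fin n → ℕ}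
    (hρ : Holds E Φ ρ) : ESub (σ.den E.interp ρ) (τ.den E.interp ρ) := by
  induction h with
  | nat h₁ h₂ => exact .nat (h₁ ρ hρ) (h₂ ρ hρ)
  | bang hdom hcod h ihd ihc =>
    exact .bang (fun a ha => ihd (holds_below.2 ⟨ha, hρ⟩))
      (fun a ha => ihc (holds_below.2 ⟨ha, hρ⟩)) (h ρ hρ)

theorem ModTy.erase_eq_nat {n : ℕ} {σ : ModTy S n} (h : σ.erase = .nat) :
    ∃ I J, σ = .nat I J := by
  cases σ with
  | nat I J => exact ⟨I, J, rfl⟩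
  | bang I σ τ => simp [ModTy.erase] at h

theorem ModTy.erase_eq_arr {n : ℕ} {σ : ModTy S n} {α β : PTy} (h : σ.erase = .arr α β) :
    ∃ I σ₁ σ₂, σ = .bang I σ₁ σ₂ ∧ σ₁.erase = α ∧ σ₂.erase = β := by
  cases σ with
  | nat I J => simp [ModTy.erase] at h
  | bang I σ τ => exact ⟨I, σ, τ, rfl, by simpa [ModTy.erase] using h⟩

/-- The erasures must be compared separately: under unsatisfiable constraints the pointwise
hypothesis is vacuous, yet subtyping still requires equal shapes. -/
theorem Sub.of_den {n : ℕ} {Φ : ICtx S n} {σ τ : ModTy S n} (he : σ.erase = τ.erase)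
    (h : ∀ ρ, Holds E Φ ρ → ESub (σ.den E.interp ρ) (τ.den E.interp ρ)) : Sub E Φ σ τ := by
  -- Both directions are proved together, since each of them uses the other one on the domain.
  suffices H : ∀ τ : ModTy S n, σ.erase = τ.erase →
      ((∀ ρ, Holds E Φ ρ → ESub (σ.den E.interp ρ) (τ.den E.interp ρ)) → Sub E Φ σ τ) ∧
      ((∀ ρ, Holds E Φ ρ → ESub (τ.den E.interp ρ) (σ.den E.interp ρ)) → Sub E Φ τ σ) from
    (H τ he).1 h
  clear h he τ
  induction σ with
  | nat I J =>
    intro τ he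
    obtain ⟨K, H, rfl⟩ := ModTy.erase_eq_nat he.symm
    refine ⟨fun h => .nat (fun ρ hρ => ?_) fun ρ hρ => ?_,
      fun h => .nat (fun ρ hρ => ?_) fun ρ hρ => ?_⟩ <;>
    · have := h ρ hρ
      simp only [ModTy.den] at this
      cases this with | nat h₁ h₂ =>
      assumption
  | bang I σ₁ σ₂ ih₁ ih₂ =>
    intro τ he
    obtain ⟨J, τ₁, τ₂, rfl, he₁, he₂⟩ := ModTy.erase_eq_arr he.symm
    have key {J' : Index S _} {υ₁ υ₂ : ModTy S _}
        (h : ∀ ρ, Holds E Φ ρ → ∀ a, PLt a (J'.eval E.interp ρ) →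
          ESub (υ₁.den E.interp (Fin.cons a ρ)) (υ₂.den E.interp (Fin.cons a ρ))) :
        ∀ ρ, Holds E (Φ.below J') ρ → ESub (υ₁.den E.interp ρ) (υ₂.den E.interp ρ) := by
      intro ρ
      induction ρ using Fin.consCases with | _ a ρ =>
      intro hρ
      have hρ := holds_below.1 hρ
      exact h ρ hρ.2 a hρ.1
    constructor
    · intro h
      refine .bang ((ih₁ _ he₁.symm).2 (key fun ρ hρ a ha => ?_))
        ((ih₂ _ he₂.symm).1 (key fun ρ hρ a ha => ?_)) fun ρ hρ => ?_
      all_goals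
        have := h ρ hρ
        simp only [ModTy.den] at this
        cases this with | bang hd hc h' =>
        first | exact hd a ha | exact hc a ha | exact h'
    · intro h
      refine .bang ((ih₁ _ he₁.symm).1 (key fun ρ hρ a ha => ?_))
        ((ih₂ _ he₂.symm).2 (key fun ρ hρ a ha => ?_)) fun ρ hρ => ?_
      all_goals
        have := h ρ hρ
        simp only [ModTy.den] at this
        cases this with | bang hd hc h' =>
        first | exact hd a ha | exact hc a ha | exact h'

theorem ModTy.den_subst {φ : Interp S} {n m : ℕ} {s : Fin n → Index S m} (σ : ModTy S n)
    {ρ : Fin m → ℕ} {ρ' : Fin n → ℕ} (h : Transforms φ s ρ ρ') :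
    (σ.subst s).den φ ρ = σ.den φ ρ' := by
  induction σ generalizing m with
  | nat I J => simp only [subst, den, Index.eval_subst _ h]
  | bang I σ τ ihσ ihτ =>
    simp only [subst, den, Index.eval_subst _ h, fun a => ihσ (h.lift a), fun a => ihτ (h.lift a)]

theorem ModTy.erase_subst {n m : ℕ} (s : Fin n → Index S m) (σ : ModTy S n) :
    (σ.subst s).erase = σ.erase := by
  induction σ generalizing m with
  | nat I J => rfl
  | bang I σ τ ihσ ihτ => simp only [subst, erase, ihσ, ihτ]

theorem ModTy.erase_inst {n : ℕ} (σ : ModTy S (n + 1)) (J : Index S n) :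
    (σ.inst J).erase = σ.erase := erase_subst _ _

theorem ModTy.den_inst_zero {φ : Interp S} {n : ℕ} (σ : ModTy S (n + 1)) (ρ : Fin n → ℕ) :
    (σ.inst .zero).den φ ρ = σ.den φ (Fin.cons 0 ρ) :=
  den_subst σ (transforms_single rfl)

/-! ## The substitutions in the sums of types and in the rule for fixpoints -/

theorem transforms_sum {φ : Interp S} {n : ℕ} {I : Index S n} {ρ : Fin n → ℕ} {i : ℕ}
    (h : i ∈ I.eval φ ρ) (b : ℕ) :
    Transforms φ (Fin.cases (.add I.wk (.var 0)) fun i => .var i.succ)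
      (Fin.cons b ρ) (Fin.cons (i + b) ρ) := by
  rw [← Part.eq_some_iff] at h
  exact Fin.cases (by simp [Index.eval, Index.eval_wk, h]) fun _ => rfl

/-- In the `a`-th summand, position `b` is shifted by the total length `s` of the summands before
it. The result no longer depends on `a` and `b` otherwise. -/
theorem transforms_bsum {φ : Interp S} {n : ℕ} {J : Index S (n + 1)} {ρ : Fin n → ℕ} {a s : ℕ}
    (h : s ∈ partialSum (fun d => J.eval φ (Fin.cons d ρ)) a) (b : ℕ) :
    Transforms φ (Fin.cases
        (.add (.var 0) (.bsum (.var 1) (J.rename (Fin.cases 0 fun i => i.succ.succ.succ))))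
        fun i => .var i.succ.succ)
      (Fin.cons b (Fin.cons a ρ)) (Fin.cons (b + s) ρ) := by
  rw [← Part.eq_some_iff] at h
  refine Fin.cases ?_ fun _ => rfl
  have e (d : ℕ) : (J.rename (Fin.cases 0 fun i => i.succ.succ.succ)).eval φ
      (Fin.cons d (Fin.cons b (Fin.cons a ρ)) : Fin (n + 3) → ℕ) =
      J.eval φ (Fin.cons d ρ) := by
    rw [Index.eval_rename]
    congr 1
    exact funext (Fin.cases rfl fun _ => rfl)
  have e1 : (Fin.cons b (Fin.cons a ρ) : Fin (n + 2) → ℕ) 1 = a := rfl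
  simp [Index.eval, e, e1, h]

theorem transforms_subtree {φ : Interp S} {n : ℕ} {I : Index S (n + 1)} {ρ : Fin n → ℕ}
    {a b y : ℕ} (h : Forest (fun v => I.eval φ (Fin.cons v ρ)) (b + 1) a y) :
    Transforms φ (Fin.cases
        (.add
          (.add
            (.fcard (.add (.var 1) .one) (.var 0)
              (I.rename (Fin.cases 0 fun i => i.succ.succ.succ)))
            (.var 1))
          .one)
        fun i => .var i.succ.succ)
      (Fin.cons a (Fin.cons b ρ)) (Fin.cons (y + b + 1) ρ) := by
  rw [← mem_forestCard, ← Part.eq_some_iff] at h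
  refine Fin.cases ?_ fun _ => rfl
  have e (d : ℕ) : (I.rename (Fin.cases 0 fun i => i.succ.succ.succ)).eval φ
      (Fin.cons d (Fin.cons a (Fin.cons b ρ)) : Fin (n + 3) → ℕ) =
      I.eval φ (Fin.cons d ρ) := by
    rw [Index.eval_rename]
    congr 1
    exact funext (Fin.cases rfl fun _ => rfl)
  have e1 : (Fin.cons a (Fin.cons b ρ) : Fin (n + 2) → ℕ) 1 = b := rfl
  simp [Index.eval, e, e1, h]

theorem transforms_tree {φ : Interp S} {n : ℕ} {I : Index S (n + 1)} {ρ : Fin n → ℕ}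
    {a y : ℕ} (h : Forest (fun v => I.eval φ (Fin.cons v ρ)) 0 a y) :
    Transforms φ (Fin.cases
        (.fcard .zero (.var 0) (I.rename (Fin.cases 0 fun i => i.succ.succ)))
        fun i => .var i.succ)
      (Fin.cons a ρ) (Fin.cons y ρ) := by
  rw [← mem_forestCard, ← Part.eq_some_iff] at h
  refine Fin.cases ?_ fun _ => rfl
  have e (d : ℕ) : (I.rename (Fin.cases 0 fun i => i.succ.succ)).eval φ
      (Fin.cons d (Fin.cons a ρ) : Fin (n + 2) → ℕ) = I.eval φ (Fin.cons d ρ) := by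
    rw [Index.eval_rename]
    congr 1
    exact funext (Fin.cases rfl fun _ => rfl)
  simp [Index.eval, e, h]

/-! ## Uniformisation of types -/

/-- A common erasure means a common tree shape, whose index terms sit at fixed fields of the codes.
Each of them is uniformised separately. -/
theorem EqProgram.Universal.exists_type (hE : E.Universal) {α : PTy} {p : ℕ}
    {σ : ℕ → ModTy S p} (hσ : Computable fun n => (σ n).code) (he : ∀ n, (σ n).erase = α) :
    ∃ σ' : ModTy S (p + 1), σ'.erase = α ∧
      ∀ ρ n, σ'.den E.interp (push ρ n) = (σ n).den E.interp ρ := by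
  induction α generalizing p with
  | nat =>
    choose I J hIJ using fun n => ModTy.erase_eq_nat (he n)
    obtain rfl : σ = fun n => .nat (I n) (J n) := funext hIJ
    obtain ⟨I', hI'⟩ := hE.exists_index (I := I)
      ((computable_field 1 hσ).of_eq fun n => by simp [ModTy.code, field_codeNode])
    obtain ⟨J', hJ'⟩ := hE.exists_index (I := J)
      ((computable_field 2 hσ).of_eq fun n => by simp [ModTy.code, field_codeNode])
    exact ⟨.nat I' J', rfl, fun ρ n => by simp only [ModTy.den, hI', hJ']⟩
  | arr α β ihα ihβ =>
    choose I σ₁ σ₂ hIσ he₁ he₂ using fun n => ModTy.erase_eq_arr (he n)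
    obtain rfl : σ = fun n => .bang (I n) (σ₁ n) (σ₂ n) := funext hIσ
    obtain ⟨I', hI'⟩ := hE.exists_index (I := I)
      ((computable_field 1 hσ).of_eq fun n => by simp [ModTy.code, field_codeNode])
    obtain ⟨σ₁', he₁', h₁⟩ := ihα (σ := σ₁)
      ((computable_field 2 hσ).of_eq fun n => by simp [ModTy.code, field_codeNode]) he₁
    obtain ⟨σ₂', he₂', h₂⟩ := ihβ (σ := σ₂)
      ((computable_field 3 hσ).of_eq fun n => by simp [ModTy.code, field_codeNode]) he₂
    exact ⟨.bang I' σ₁' σ₂', by simp only [ModTy.erase, he₁', he₂'], fun ρ n => by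
      simp only [ModTy.den, hI', cons_push, h₁, h₂]⟩

/-! ## Sums of types -/

theorem partialSum_mono {g : ℕ → Part ℕ} {a b s t : ℕ} (hs : s ∈ partialSum g a)
    (ht : t ∈ partialSum g b) (h : a ≤ b) : s ≤ t := by
  obtain ⟨d, rfl⟩ := Nat.exists_eq_add_of_le h
  obtain ⟨r, -, rfl⟩ := partialSum_add_inv hs ht
  omega

theorem partialSum_zero (m : ℕ) : partialSum (fun _ => Part.some 0) m = Part.some 0 := by
  induction m with
  | zero => rfl
  | succ m ih => simp [partialSum, ih]

theorem mem_eval_bsum {φ : Interp S} {n : ℕ} {I : Index S n} {J : Index S (n + 1)}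
    {ρ : Fin n → ℕ} {z : ℕ} : z ∈ (Index.bsum I J).eval φ ρ ↔
      ∃ m ∈ I.eval φ ρ, z ∈ partialSum (fun a => J.eval φ (Fin.cons a ρ)) m := by
  simp [Index.eval]

theorem mem_eval_add {φ : Interp S} {n : ℕ} {I J : Index S n} {ρ : Fin n → ℕ} {z : ℕ} :
    z ∈ (Index.add I J).eval φ ρ ↔ ∃ x ∈ I.eval φ ρ, ∃ y ∈ J.eval φ ρ, x + y = z := by
  simp [Index.eval]

theorem exists_partialSum_of_bsum_dom {φ : Interp S} {n : ℕ} {I : Index S n}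
    {J : Index S (n + 1)} {ρ : Fin n → ℕ} (h : ((Index.bsum I J).eval φ ρ).Dom) {a : ℕ}
    (ha : PLt a (I.eval φ ρ)) :
    ∃ s ∈ partialSum (fun a => J.eval φ (Fin.cons a ρ)) a,
      ∃ j ∈ J.eval φ (Fin.cons a ρ), ∃ z ∈ (Index.bsum I J).eval φ ρ, s + j ≤ z := by
  obtain ⟨z, hz⟩ := Part.dom_iff_mem.1 h
  obtain ⟨m, hm, hz'⟩ := mem_eval_bsum.1 hz
  obtain ⟨m', hm', ham⟩ := ha
  obtain rfl := Part.mem_unique hm hm'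
  have hd := partialSum_dom_of_le (show a + 1 ≤ m from ham) (Part.dom_iff_mem.2 ⟨z, hz'⟩)
  obtain ⟨t, ht⟩ := Part.dom_iff_mem.1 hd
  obtain ⟨s, hs, j, hj, rfl⟩ := mem_partialSum_succ.1 ht
  exact ⟨s, hs, j, hj, z, hz, partialSum_mono ht hz' ham⟩

/-- A defined bounded sum has all its partial sums and summands defined, and position `b` of summand
`a` lies below the total bound. Together with `Sum.def` this yields well-defined contexts for the
premises from those of the conclusion. -/
theorem BSum.def {n : ℕ} {Φ : ICtx S n} {I : Index S n} {σ : ModTy S (n + 1)} {δ : ModTy S n}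
    (h : BSum I σ δ) (hδ : δ.Def E Φ) : σ.Def E (Φ.below I) := by
  rw [ModTy.def_iff] at hδ ⊢
  intro ρ
  induction ρ using Fin.consCases with | _ a ρ =>
  intro hρ
  obtain ⟨ha, hρ⟩ := holds_below.1 hρ
  have hδ := hδ ρ hρ
  cases h with
  | nat J K =>
    simpa only [ModTy.den, Index.eval_wk] using hδ
  | modal J A =>
    obtain ⟨s, hs, j, hj, z, hz, hle⟩ := exists_partialSum_of_bsum_dom hδ.1 ha
    refine ⟨Part.dom_iff_mem.2 ⟨j, hj⟩, fun b hb => ?_⟩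
    obtain ⟨j', hj', hb⟩ := hb
    obtain rfl := Part.mem_unique hj hj'
    have := hδ.2 (b + s) ⟨z, hz, by omega⟩
    simpa only [LinTy.subst, ModTy.den_subst _ (transforms_bsum hs b)] using this

theorem Sum.def {n : ℕ} {Φ : ICtx S n} {γ δ υ : ModTy S n} (h : Sum γ δ υ)
    (hυ : υ.Def E Φ) : γ.Def E Φ ∧ δ.Def E Φ := by
  cases h with
  | nat I J => exact ⟨hυ, hυ⟩
  | modal I J A =>
    simp only [ModTy.def_iff] at hυ ⊢
    refine ⟨fun ρ hρ => ?_, fun ρ hρ => ?_⟩ <;> obtain ⟨hd, hA⟩ := hυ ρ hρ <;>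
      obtain ⟨z, hz⟩ := Part.dom_iff_mem.1 hd <;>
      obtain ⟨i, hi, j, hj, rfl⟩ := mem_eval_add.1 hz
    · refine ⟨Part.dom_iff_mem.2 ⟨i, hi⟩, fun a ha => hA a ⟨i + j, hz, ?_⟩⟩
      obtain ⟨i', hi', ha⟩ := ha
      obtain rfl := Part.mem_unique hi hi'
      omega
    · refine ⟨Part.dom_iff_mem.2 ⟨j, hj⟩, fun b hb => ?_⟩
      obtain ⟨j', hj', hb⟩ := hb
      obtain rfl := Part.mem_unique hj hj'
      have := hA (i + b) ⟨i + j, hz, by omega⟩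
      simpa only [LinTy.subst, ModTy.den_subst _ (transforms_sum hi b)] using this

/-- Uniformising `σ` and `δ` independently would lose the syntactic relation between them. Instead
the ingredients `J` and `A` are uniformised and the sum is formed anew. The summands agree only for
`a` below a defined bound, where the partial sum in the substitution has a value. -/
theorem EqProgram.Universal.exists_bsum (hE : E.Universal) {p : ℕ} {I : ℕ → Index S p}
    {I' : Index S (p + 1)}
    (hI : ∀ ρ n, I'.eval E.interp (push ρ n) = (I n).eval E.interp ρ)
    {σ : ℕ → ModTy S (p + 1)} {δ : ℕ → ModTy S p} (h : ∀ n, BSum (I n) (σ n) (δ n))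
    (hσ : Computable fun n => (σ n).code) (hδ : Computable fun n => (δ n).code) {α : PTy}
    (he : ∀ n, (δ n).erase = α) :
    ∃ σ' δ', BSum I' σ' δ' ∧ σ'.erase = α ∧ δ'.erase = α ∧ (∀ n, (σ n).erase = α) ∧
      ∀ ρ n, ((δ n).den E.interp ρ).Def →
        δ'.den E.interp (push ρ n) = (δ n).den E.interp ρ ∧
        ∀ a, PLt a ((I n).eval E.interp ρ) →
          σ'.den E.interp (push (Fin.cons a ρ) n) = (σ n).den E.interp (Fin.cons a ρ) := by
  cases α with
  | nat =>
    have inv : ∀ n, ∃ J K, σ n = .nat J.wk K.wk ∧ δ n = .nat J K := fun n => by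
      have h := h n
      have he := he n
      generalize σ n = s, δ n = d at h he
      cases h with
      | nat J K => exact ⟨J, K, rfl, rfl⟩
      | modal J A => simp [ModTy.modal, ModTy.erase] at he
    choose J K hJK hδJ using inv
    obtain rfl : σ = fun n => .nat (J n).wk (K n).wk := funext hJK
    obtain rfl : δ = fun n => .nat (J n) (K n) := funext hδJ
    obtain ⟨J', hJ'⟩ := hE.exists_index (I := J)
      ((computable_field 1 hδ).of_eq fun n => by simp [ModTy.code, field_codeNode])
    obtain ⟨K', hK'⟩ := hE.exists_index (I := K)
      ((computable_field 2 hδ).of_eq fun n => by simp [ModTy.code, field_codeNode])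
    refine ⟨_, _, .nat I' J' K', rfl, rfl, fun _ => rfl, fun ρ n _ => ⟨?_, fun a _ => ?_⟩⟩
    · simp only [ModTy.den, hJ', hK']
    · simp only [ModTy.den, ← cons_push, Index.eval_wk, hJ', hK']
  | arr α β =>
    have inv : ∀ n, ∃ (J : Index S (p + 1)) (A : LinTy S (p + 1)),
        σ n = .modal J (A.subst (Fin.cases
          (.add (.var 0)
            (.bsum (.var 1) (J.rename (Fin.cases 0 fun i => i.succ.succ.succ))))
          fun i => .var i.succ.succ)) ∧ δ n = .modal (.bsum (I n) J) A := fun n => by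
      have h := h n
      have he := he n
      generalize σ n = s, δ n = d at h he
      cases h with
      | nat J K => simp [ModTy.erase] at he
      | modal J A => exact ⟨J, A, rfl, rfl⟩
    choose J A hσJ hδJ using inv
    obtain rfl := funext hσJ
    obtain rfl := funext hδJ
    have heA (n : ℕ) : (A n).dom.erase = α ∧ (A n).cod.erase = β := by
      simpa [ModTy.modal, ModTy.erase] using he n
    -- The bound `J` is read off the summand, and `A` off the total, since the summand contains it
    -- only after a substitution.
    obtain ⟨J', hJ'⟩ := hE.exists_index (I := J)
      ((computable_field 1 hσ).of_eq fun n => by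
        simp [ModTy.modal, ModTy.code, field_codeNode])
    obtain ⟨A₁, he₁, hA₁⟩ := hE.exists_type (σ := fun n => (A n).dom)
      ((computable_field 2 hδ).of_eq fun n => by
        simp [ModTy.modal, ModTy.code, field_codeNode]) fun n => (heA n).1
    obtain ⟨A₂, he₂, hA₂⟩ := hE.exists_type (σ := fun n => (A n).cod)
      ((computable_field 3 hδ).of_eq fun n => by
        simp [ModTy.modal, ModTy.code, field_codeNode]) fun n => (heA n).2
    refine ⟨_, _, .modal I' J' ⟨A₁, A₂⟩, ?_, ?_, fun n => ?_, fun ρ n hd => ⟨?_, ?_⟩⟩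
    · simp only [ModTy.modal, LinTy.subst, ModTy.erase, ModTy.erase_subst, he₁, he₂]
    · simp only [ModTy.modal, ModTy.erase, he₁, he₂]
    · simp only [ModTy.modal, LinTy.subst, ModTy.erase, ModTy.erase_subst, heA n]
    · simp only [ModTy.modal, ModTy.den, Index.eval, hI, hJ', cons_push, hA₁, hA₂]
    · intro a ha
      obtain ⟨s, hs, -⟩ := exists_partialSum_of_bsum_dom hd.1 ha
      have hs' : s ∈ partialSum
          (fun d => J'.eval E.interp (Fin.cons d (push ρ n))) a := by
        simpa only [cons_push, hJ'] using hs
      simp only [ModTy.modal, LinTy.subst, ModTy.den, hJ']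
      simp only [← cons_push, ModTy.den_subst _ (transforms_bsum hs _),
        ModTy.den_subst _ (transforms_bsum hs' _)]
      simp only [cons_push, hA₁, hA₂]

/-- The code of an entry of a context. -/
def entryCode {n : ℕ} (o : Option (ModTy S n)) : ℕ := Encodable.encode (o.map ModTy.code)

theorem entryCode_some {n : ℕ} (σ : ModTy S n) : entryCode (some σ) = σ.code + 1 := by
  simp [entryCode]

theorem entryCode_none {n : ℕ} : entryCode (none : Option (ModTy S n)) = 0 := rfl

theorem computable_code_of_entry {p : ℕ} {γ : ℕ → Option (ModTy S p)} {σ : ℕ → ModTy S p}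
    (h : ∀ n, γ n = some (σ n)) (hγ : Computable fun n => entryCode (γ n)) :
    Computable fun n => (σ n).code :=
  (Primrec.pred.to_comp.comp hγ).of_eq fun n => by simp [h, entryCode_some]

/-- The bound of a modal type in a context, where a missing type counts as having bound `0`. -/
def EntryBound {n : ℕ} (o : Option (ModTy S n)) (I : Index S n) : Prop :=
  o = none ∧ I = .zero ∨ ∃ σ τ, o = some (.bang I σ τ)

theorem computable_entryBound {p : ℕ} {γ : ℕ → Option (ModTy S p)} {I : ℕ → Index S p}
    (h : ∀ n, EntryBound (γ n) (I n)) (hγ : Computable fun n => entryCode (γ n)) :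
    Computable fun n => (I n).code := by
  refine (Computable.cond ((Primrec.eq (α := ℕ)).decide.to_comp.comp hγ (Computable.const 0))
    -- This is the code of the index term `0`, used for a missing entry; a present entry has its
    -- code increased by one.
    (Computable.const (codeNode 1 []))
    (computable_field 1 (Primrec.pred.to_comp.comp hγ))).of_eq fun n => ?_
  rcases h n with ⟨h, hI⟩ | ⟨σ, τ, h⟩
  · simp [h, hI, entryCode_none, Index.code]
  · simp [h, entryCode_some, ModTy.code, field_codeNode]

/-- Whether both summands are present may depend on `n`. The uniform sum always has two summands: a
modal type missing at index `n` gets a bound of value `0` there, so that the total is unchanged. For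
`Nat` all three types are the same. -/
theorem EqProgram.Universal.exists_sum (hE : E.Universal) {p : ℕ}
    {γ δ : ℕ → Option (ModTy S p)} {υ : ℕ → ModTy S p}
    (h : ∀ n, SumOpt (γ n) (δ n) (some (υ n)))
    (hγ : Computable fun n => entryCode (γ n)) (hδ : Computable fun n => entryCode (δ n))
    (hυ : Computable fun n => (υ n).code) {α : PTy} (he : ∀ n, (υ n).erase = α) :
    ∃ γ' δ' υ', Sum γ' δ' υ' ∧ γ'.erase = α ∧ δ'.erase = α ∧ υ'.erase = α ∧
      (∀ n, ∀ σ ∈ γ n, σ.erase = α) ∧ (∀ n, ∀ σ ∈ δ n, σ.erase = α) ∧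
      ∀ ρ n, ((υ n).den E.interp ρ).Def →
        υ'.den E.interp (push ρ n) = (υ n).den E.interp ρ ∧
        (∀ σ ∈ γ n, γ'.den E.interp (push ρ n) = σ.den E.interp ρ) ∧
        ∀ σ ∈ δ n, δ'.den E.interp (push ρ n) = σ.den E.interp ρ := by
  cases α with
  | nat =>
    choose I J hIJ using fun n => ModTy.erase_eq_nat (he n)
    obtain rfl := funext hIJ
    have inv : ∀ n, (∀ σ ∈ γ n, σ = .nat (I n) (J n)) ∧ ∀ σ ∈ δ n, σ = .nat (I n) (J n) :=
      fun n => by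
        have h := h n
        generalize γ n = g, δ n = d at h
        cases h with
        | left => simp
        | right => simp
        | both h => cases h; simp
    obtain ⟨υ', he', hυ'⟩ := hE.exists_type hυ he
    obtain ⟨I', J', rfl⟩ := ModTy.erase_eq_nat he'
    refine ⟨_, _, _, .nat I' J', rfl, rfl, rfl, ?_, ?_, fun ρ n _ => ⟨hυ' ρ n, ?_, ?_⟩⟩
    · intro n σ hσ; rw [(inv n).1 σ hσ]; rfl
    · intro n σ hσ; rw [(inv n).2 σ hσ]; rfl
    · intro σ hσ; rw [(inv n).1 σ hσ, hυ']
    · intro σ hσ; rw [(inv n).2 σ hσ, hυ']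
  | arr α β =>
    -- The three forms of the sum are brought to one: the total bound has the value of `I + J`, with
    -- `I` or `J` equal to `0` when that summand is missing, and the right summand is `A` shifted by
    -- `I`.
    have inv : ∀ n, ∃ (M I J : Index S p) (A : LinTy S (p + 1)), υ n = .modal M A ∧
        (∀ ρ, M.eval E.interp ρ = (Index.add I J).eval E.interp ρ) ∧
        EntryBound (γ n) I ∧ EntryBound (δ n) J ∧ (∀ σ ∈ γ n, σ = .modal I A) ∧
        ∀ σ ∈ δ n, ∃ B : LinTy S (p + 1), σ = .modal J B ∧
          B.dom.erase = A.dom.erase ∧ B.cod.erase = A.cod.erase ∧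
          ∀ ρ, ∀ i ∈ I.eval E.interp ρ, ∀ b,
            B.dom.den E.interp (Fin.cons b ρ) = A.dom.den E.interp (Fin.cons (i + b) ρ) ∧
            B.cod.den E.interp (Fin.cons b ρ) = A.cod.den E.interp (Fin.cons (i + b) ρ) :=
      fun n => by
        have h := h n
        obtain ⟨M, σ, τ, hM, -⟩ := ModTy.erase_eq_arr (he n)
        rw [hM] at h ⊢
        generalize γ n = g, δ n = d at h
        generalize hu : ModTy.bang M σ τ = u at h
        cases h with
        | left =>
          subst hu
          refine ⟨M, M, .zero, ⟨σ, τ⟩, rfl, fun ρ => ?_, .inr ⟨σ, τ, rfl⟩, .inl ⟨rfl, rfl⟩,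
            by simp [ModTy.modal], by simp⟩
          simp [Index.eval, Part.bind_some_right]
        | right =>
          subst hu
          refine ⟨M, .zero, M, ⟨σ, τ⟩, rfl, fun ρ => ?_, .inl ⟨rfl, rfl⟩, .inr ⟨σ, τ, rfl⟩,
            by simp, ?_⟩
          · simp [Index.eval, Part.map_id']
          · rintro _ ⟨⟩
            refine ⟨⟨σ, τ⟩, rfl, rfl, rfl, fun ρ i hi b => ?_⟩
            obtain rfl : i = 0 := by simpa [Index.eval] using hi
            simp
        | both h =>
          cases h with
          | nat I J => cases hu
          | modal I J A =>
            refine ⟨_, I, J, A, rfl, fun _ => rfl, .inr ⟨_, _, rfl⟩, .inr ⟨_, _, rfl⟩,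
              by simp, ?_⟩
            rintro _ ⟨⟩
            refine ⟨_, rfl, ModTy.erase_subst _ _, ModTy.erase_subst _ _,
              fun ρ i hi b => ⟨?_, ?_⟩⟩ <;>
            exact ModTy.den_subst _ (transforms_sum hi b)
    choose M I J A hυM hM hIb hJb hγA hδB using inv
    obtain rfl := funext hυM
    have heA (n : ℕ) : (A n).dom.erase = α ∧ (A n).cod.erase = β := by
      simpa [ModTy.modal, ModTy.erase] using he n
    obtain ⟨I', hI'⟩ := hE.exists_index (computable_entryBound hIb hγ)
    obtain ⟨J', hJ'⟩ := hE.exists_index (computable_entryBound hJb hδ)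
    obtain ⟨A₁, he₁, hA₁⟩ := hE.exists_type (σ := fun n => (A n).dom)
      ((computable_field 2 hυ).of_eq fun n => by
        simp [ModTy.modal, ModTy.code, field_codeNode]) fun n => (heA n).1
    obtain ⟨A₂, he₂, hA₂⟩ := hE.exists_type (σ := fun n => (A n).cod)
      ((computable_field 3 hυ).of_eq fun n => by
        simp [ModTy.modal, ModTy.code, field_codeNode]) fun n => (heA n).2
    refine ⟨_, _, _, .modal I' J' ⟨A₁, A₂⟩, ?_, ?_, ?_, fun n σ hσ => ?_, fun n σ hσ => ?_,
      fun ρ n hd => ⟨?_, fun σ hσ => ?_, fun σ hσ => ?_⟩⟩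
    · simp only [ModTy.modal, ModTy.erase, he₁, he₂]
    · simp only [ModTy.modal, LinTy.subst, ModTy.erase, ModTy.erase_subst, he₁, he₂]
    · simp only [ModTy.modal, ModTy.erase, he₁, he₂]
    · rw [hγA n σ hσ]
      simp only [ModTy.modal, ModTy.erase, heA n]
    · obtain ⟨B, rfl, hB₁, hB₂, -⟩ := hδB n σ hσ
      simp only [ModTy.modal, ModTy.erase, hB₁, hB₂, heA n]
    · simp only [ModTy.modal, ModTy.den, hM, Index.eval, hI', hJ', cons_push, hA₁, hA₂]
    · rw [hγA n σ hσ]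
      simp only [ModTy.modal, ModTy.den, hI', cons_push, hA₁, hA₂]
    · obtain ⟨B, rfl, -, -, hB⟩ := hδB n σ hσ
      have hd := hd.1
      rw [hM] at hd
      obtain ⟨z, hz⟩ := Part.dom_iff_mem.1 hd
      obtain ⟨i, hi, -⟩ := mem_eval_add.1 hz
      have hi' : i ∈ I'.eval E.interp (push ρ n) := by rwa [hI']
      simp only [ModTy.modal, LinTy.subst, ModTy.den, hJ', hB ρ i hi,
        ModTy.den_subst _ (transforms_sum hi' _)]
      simp only [cons_push, hA₁, hA₂]

/-! ## Uniformisation of sums of contexts -/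

def Ctx.Def (E : EqProgram S) {k n : ℕ} (Φ : ICtx S n) (Γ : Ctx S k n) : Prop :=
  ∀ x, ∀ σ ∈ Γ x, σ.Def E Φ

/-- At index `n` of the family, `σ'` is a subtype of `σ` under the constraints `Φ'`. -/
def TyBelow (E : EqProgram S) {p : ℕ} (Φ' : ICtx S (p + 1)) (σ' : ModTy S (p + 1)) (n : ℕ)
    (σ : ModTy S p) : Prop :=
  σ'.erase = σ.erase ∧ ∀ ρ, Holds E Φ' (push ρ n) →
    ESub (σ'.den E.interp (push ρ n)) (σ.den E.interp ρ)

/-- `Γ'` is below all members of a family of contexts, at those variables which are declared in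
all of them. -/
def CtxBelow (E : EqProgram S) {k p : ℕ} (Φ' : ICtx S (p + 1)) (Γ' : Ctx S k (p + 1))
    (Γ : ℕ → Ctx S k p) : Prop :=
  ∀ x, (∀ n, (Γ n x).isSome) → ∃ σ' ∈ Γ' x, ∀ n, ∀ σ ∈ Γ n x, TyBelow E Φ' σ' n σ

/-- The constraints `Φ'` imply those of each member of a family. -/
def Implies (E : EqProgram S) {p : ℕ} (Φ' : ICtx S (p + 1)) (Φ : ℕ → ICtx S p) : Prop :=
  ∀ ρ n, Holds E Φ' (push ρ n) → Holds E (Φ n) ρ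

/-- The value of `I'` at index `n` is that of `I n`. -/
def Uniform (E : EqProgram S) {p : ℕ} (I' : Index S (p + 1)) (I : ℕ → Index S p) : Prop :=
  ∀ ρ n, I'.eval E.interp (push ρ n) = (I n).eval E.interp ρ

theorem Uniform.add {p : ℕ} {I' J' : Index S (p + 1)} {I J : ℕ → Index S p}
    (hI : Uniform E I' I) (hJ : Uniform E J' J) :
    Uniform E (.add I' J') fun n => .add (I n) (J n) := fun ρ n => by
  simp only [Index.eval, hI ρ n, hJ ρ n]

theorem Uniform.bsum {p : ℕ} {I' : Index S (p + 1)} {J' : Index S (p + 2)}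
    {I : ℕ → Index S p} {J : ℕ → Index S (p + 1)} (hI : Uniform E I' I)
    (hJ : Uniform E J' J) : Uniform E (.bsum I' J') fun n => .bsum (I n) (J n) := fun ρ n => by
  simp only [Index.eval, hI ρ n, cons_push, hJ _ n]

theorem Implies.below {p : ℕ} {Φ' : ICtx S (p + 1)} {Φ : ℕ → ICtx S p} (h : Implies E Φ' Φ)
    {I' : Index S (p + 1)} {I : ℕ → Index S p} (hI : Uniform E I' I) :
    Implies E (Φ'.below I') fun n => (Φ n).below (I n) := by
  intro ρ n
  induction ρ using Fin.consCases with | _ a ρ =>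
  intro hρ
  obtain ⟨ha, hρ⟩ := holds_below_push.1 hρ
  exact holds_below.2 ⟨hI ρ n ▸ ha, h ρ n hρ⟩

theorem Implies.cons {p : ℕ} {Φ' : ICtx S (p + 1)} {Φ : ℕ → ICtx S p} (h : Implies E Φ' Φ)
    {I' J' : Index S (p + 1)} {I J : ℕ → Index S p} (hI : Uniform E I' I)
    (hJ : Uniform E J' J) : Implies E (⟨I', J'⟩ :: Φ') fun n => ⟨I n, J n⟩ :: Φ n := by
  intro ρ n hρ
  rw [holds_cons, hI, hJ] at hρ
  exact holds_cons.2 ⟨hρ.1, h ρ n hρ.2⟩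

theorem Implies.def {p : ℕ} {Φ' : ICtx S (p + 1)} {Φ : ℕ → ICtx S p} (h : Implies E Φ' Φ)
    {I' : Index S (p + 1)} {I : ℕ → Index S p} (hI : Uniform E I' I)
    (hd : ∀ n, DlPCF.Def E (Φ n) (I n)) : DlPCF.Def E Φ' I' := by
  rw [def_iff]
  intro ρ hρ
  obtain ⟨ρ, n, rfl⟩ := exists_push ρ
  rw [hI]
  exact def_iff.1 (hd n) ρ (h ρ n hρ)

theorem Implies.ty_def {p : ℕ} {Φ' : ICtx S (p + 1)} {Φ : ℕ → ICtx S p} (h : Implies E Φ' Φ)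
    {σ' : ModTy S (p + 1)} {σ : ℕ → ModTy S p}
    (hσ : ∀ ρ n, ((σ n).den E.interp ρ).Def → Holds E Φ' (push ρ n) →
      σ'.den E.interp (push ρ n) = (σ n).den E.interp ρ)
    (hd : ∀ n, (σ n).Def E (Φ n)) : σ'.Def E Φ' := by
  rw [ModTy.def_iff]
  intro ρ hρ
  obtain ⟨ρ, n, rfl⟩ := exists_push ρ
  have hd := ModTy.def_iff.1 (hd n) ρ (h ρ n hρ)
  rw [hσ ρ n hd hρ]
  exact hd

theorem Ctx.Def.snoc {k n : ℕ} {Φ : ICtx S n} {Γ : Ctx S k n} {σ : ModTy S n}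
    (hΓ : Γ.Def E Φ) (hσ : σ.Def E Φ) : (Γ.snoc σ).Def E Φ :=
  Fin.cases (fun τ hτ => by
    obtain rfl : σ = τ := by simpa [Ctx.snoc] using hτ
    exact hσ) fun x τ hτ => hΓ x τ (by simpa [Ctx.snoc] using hτ)

theorem CtxBelow.snoc {k p : ℕ} {Φ' : ICtx S (p + 1)} {Γ' : Ctx S k (p + 1)}
    {Γ : ℕ → Ctx S k p} {σ' : ModTy S (p + 1)} {σ : ℕ → ModTy S p} (hΓ : CtxBelow E Φ' Γ' Γ)
    (hσ : ∀ n, TyBelow E Φ' σ' n (σ n)) :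
    CtxBelow E Φ' (Γ'.snoc σ') fun n => (Γ n).snoc (σ n) := by
  refine Fin.cases (fun _ => ⟨σ', by simp [Ctx.snoc], fun n τ hτ => ?_⟩) fun x hx => ?_
  · obtain rfl : σ n = τ := by simpa [Ctx.snoc] using hτ
    exact hσ n
  · simpa [Ctx.snoc] using hΓ x (by simpa [Ctx.snoc] using hx)

theorem CtxBelow.mono {k p : ℕ} {Φ' Φ'' : ICtx S (p + 1)} {Γ' : Ctx S k (p + 1)}
    {Γ : ℕ → Ctx S k p} (hΓ : CtxBelow E Φ' Γ' Γ)
    (h : ∀ ρ, Holds E Φ'' ρ → Holds E Φ' ρ) : CtxBelow E Φ'' Γ' Γ := by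
  intro x hx
  obtain ⟨σ', hσ', H⟩ := hΓ x hx
  exact ⟨σ', hσ', fun n σ hσ => ⟨(H n σ hσ).1, fun ρ hρ => (H n σ hσ).2 ρ (h _ hρ)⟩⟩

theorem Ctx.Def.mono {k n : ℕ} {Φ Φ' : ICtx S n} {Γ : Ctx S k n} (hΓ : Γ.Def E Φ)
    (h : ∀ ρ, Holds E Φ' ρ → Holds E Φ ρ) : Γ.Def E Φ' := fun x σ hσ =>
  ModTy.def_iff.2 fun ρ hρ => ModTy.def_iff.1 (hΓ x σ hσ) ρ (h ρ hρ)

/-- The given `Δ'` is only a lower bound of the family, so it need not be a syntactic sum. The sum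
`Δ''` is built from the uniformised types and lies above `Δ'`, to be reached by subsumption. -/
theorem EqProgram.Universal.exists_ctx_bsum (hE : E.Universal) {k p : ℕ}
    {Φ' : ICtx S (p + 1)} {Φ : ℕ → ICtx S p} (hΦ : Implies E Φ' Φ) {I : ℕ → Index S p}
    {I' : Index S (p + 1)} (hI : Uniform E I' I) (hId : DlPCF.Def E Φ' I')
    {Γ : ℕ → Ctx S k (p + 1)} {Δ : ℕ → Ctx S k p} (h : ∀ n, Ctx.BSum (I n) (Γ n) (Δ n))
    (hΓ : ∀ x, Computable fun n => entryCode (Γ n x))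
    (hΔ : ∀ x, Computable fun n => entryCode (Δ n x)) (hΔd : ∀ n, (Δ n).Def E (Φ n))
    {Δ' : Ctx S k (p + 1)} (hΔ' : CtxBelow E Φ' Δ' Δ) (hΔd' : Δ'.Def E Φ') :
    ∃ Γ'' Δ'', Ctx.BSum I' Γ'' Δ'' ∧ Ctx.Sub E Φ' Δ' Δ'' ∧ Δ''.Def E Φ' ∧
      Γ''.Def E (Φ'.below I') ∧ CtxBelow E (Φ'.below I') Γ'' Γ := by
  have main : ∀ x, ∃ g d, Option.Rel (BSum I') g d ∧ Option.Rel (DlPCF.Sub E Φ') (Δ' x) d ∧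
      (∀ σ ∈ d, σ.Def E Φ') ∧ ((∀ n, (Γ n x).isSome) → ∃ σ' ∈ g, ∀ n, ∀ σ ∈ Γ n x,
        TyBelow E (Φ'.below I') σ' n σ) := by
    intro x
    by_cases hx : ∀ n, (Γ n x).isSome
    · choose σ hσ using fun n => Option.isSome_iff_exists.1 (hx n)
      have : ∀ n, ∃ δ, Δ n x = some δ ∧ BSum (I n) (σ n) δ := fun n => by
        have := h n x
        rw [hσ n] at this
        generalize Δ n x = d at this
        cases this with | some h => exact ⟨_, rfl, h⟩
      choose δ hδ hsum using this
      obtain ⟨δ', hδ', hlow⟩ := hΔ' x fun n => by simp [hδ n]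
      obtain ⟨σ'', δ'', hsum'', hσe'', hδe'', hσe, hden⟩ := hE.exists_bsum hI hsum
        (computable_code_of_entry hσ (hΓ x)) (computable_code_of_entry hδ (hΔ x))
        (α := δ'.erase) fun n => (hlow n _ (hδ n)).1.symm
      have hd (ρ n) (hρ : Holds E Φ' (push ρ n)) : ((δ n).den E.interp ρ).Def :=
        ModTy.def_iff.1 (hΔd n x _ (hδ n)) ρ (hΦ ρ n hρ)
      have hdef : δ''.Def E Φ' := hΦ.ty_def (fun ρ n hd _ => (hden ρ n hd).1)
        fun n => hΔd n x _ (hδ n)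
      refine ⟨some σ'', some δ'', .some hsum'', ?_, ?_, fun _ => ⟨σ'', rfl, ?_⟩⟩
      · rw [Option.mem_def] at hδ'
        rw [hδ']
        refine .some (.of_den hδe''.symm fun ρ hρ => ?_)
        obtain ⟨ρ, n, rfl⟩ := exists_push ρ
        rw [(hden ρ n (hd ρ n hρ)).1]
        exact (hlow n _ (hδ n)).2 ρ hρ
      · rintro _ ⟨⟩; exact hdef
      · intro n τ hτ
        obtain rfl : σ n = τ := by simpa [hσ n] using hτ
        refine ⟨by rw [hσe'', hσe], fun ρ => ?_⟩
        induction ρ using Fin.consCases with | _ a ρ =>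
        intro hρ
        have hσd := ModTy.def_iff.1 (hsum''.def hdef) _ hρ
        obtain ⟨ha, hρ⟩ := holds_below_push.1 hρ
        rw [hI] at ha
        rw [← (hden ρ n (hd ρ n hρ)).2 a ha]
        exact .refl hσd
    · cases hx' : Δ' x with
      | none => exact ⟨none, none, .none, .none, by simp, fun h => absurd h hx⟩
      | some σ =>
        have hσ := hΔd' x σ hx'
        cases σ with
        | nat J K =>
          refine ⟨_, _, .some (.nat I' J K), .some (.of_den rfl fun ρ hρ => .refl ?_), ?_,
            fun h => absurd h hx⟩
          · exact ModTy.def_iff.1 hσ ρ hρ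
          · rintro _ ⟨⟩; exact hσ
        | bang M σ τ =>
          have hz (ρ) (hρ : Holds E Φ' ρ) :
              (Index.bsum I' .zero).eval E.interp ρ = Part.some 0 := by
            obtain ⟨m, hm⟩ := Part.dom_iff_mem.1 (def_iff.1 hId ρ hρ)
            rw [← Part.eq_some_iff] at hm
            simp [Index.eval, hm, partialSum_zero]
          -- Nothing is demanded of a variable which some member does not declare, but a declaration
          -- in `Δ'` still has to be above-bounded by a sum. Summands with bound `0` do, since every
          -- modal type is a subtype of the same type with bound `0`; the sum of zeros has a value
          -- because `I'` is defined.
          refine ⟨_, _, .some (.modal I' .zero ⟨σ, τ⟩),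
            .some (.of_den rfl fun ρ hρ => ?_), ?_, fun h => absurd h hx⟩
          · simp only [ModTy.modal, ModTy.den, hz ρ hρ]
            exact .bang (fun a ha => absurd ha not_PLt_zero)
              (fun a ha => absurd ha not_PLt_zero)
              (zero_PLe (ModTy.def_iff.1 hσ ρ hρ).1)
          · rintro _ ⟨⟩
            rw [ModTy.def_iff]
            intro ρ hρ
            simp only [ModTy.modal, ModTy.den, hz ρ hρ]
            exact ⟨trivial, fun a ha => absurd ha not_PLt_zero⟩
  choose g d hsum hsub hdef hlow using main
  refine ⟨g, d, hsum, hsub, hdef, fun x σ hσ => ?_, hlow⟩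
  have h := hsum x
  have hd := hdef x
  rw [Option.mem_def] at hσ
  rw [hσ] at h
  generalize d x = δ at h hd
  cases h with | some h => exact h.def (hd _ rfl)

theorem EqProgram.Universal.exists_ctx_sum (hE : E.Universal) {k p : ℕ}
    {Φ' : ICtx S (p + 1)} {Φ : ℕ → ICtx S p} (hΦ : Implies E Φ' Φ)
    {Γ Δ Ξ : ℕ → Ctx S k p} (h : ∀ n, Ctx.Sum (Γ n) (Δ n) (Ξ n))
    (hΓ : ∀ x, Computable fun n => entryCode (Γ n x))
    (hΔ : ∀ x, Computable fun n => entryCode (Δ n x))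
    (hΞ : ∀ x, Computable fun n => entryCode (Ξ n x)) (hΞd : ∀ n, (Ξ n).Def E (Φ n))
    {Ξ' : Ctx S k (p + 1)} (hΞ' : CtxBelow E Φ' Ξ' Ξ) (hΞd' : Ξ'.Def E Φ') :
    ∃ Γ'' Δ'' Ξ'', Ctx.Sum Γ'' Δ'' Ξ'' ∧ Ctx.Sub E Φ' Ξ' Ξ'' ∧ Ξ''.Def E Φ' ∧
      Γ''.Def E Φ' ∧ CtxBelow E Φ' Γ'' Γ ∧ Δ''.Def E Φ' ∧ CtxBelow E Φ' Δ'' Δ := by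
  have main : ∀ x, ∃ g d u, SumOpt g d u ∧ Option.Rel (DlPCF.Sub E Φ') (Ξ' x) u ∧
      (∀ σ ∈ u, σ.Def E Φ') ∧ (∀ σ ∈ g, σ.Def E Φ') ∧ ((∀ n, (Γ n x).isSome) →
        ∃ σ' ∈ g, ∀ n, ∀ σ ∈ Γ n x, TyBelow E Φ' σ' n σ) ∧ (∀ σ ∈ d, σ.Def E Φ') ∧
      ((∀ n, (Δ n x).isSome) → ∃ σ' ∈ d, ∀ n, ∀ σ ∈ Δ n x, TyBelow E Φ' σ' n σ) := by
    intro x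
    by_cases hx : ∀ n, (Ξ n x).isSome
    · choose υ hυ using fun n => Option.isSome_iff_exists.1 (hx n)
      obtain ⟨υ', hυ', hlow⟩ := hΞ' x hx
      obtain ⟨γ'', δ'', υ'', hsum, hγe, hδe, hυe, hγe', hδe', hden⟩ := hE.exists_sum
        (fun n => hυ n ▸ h n x) (hΓ x) (hΔ x) (computable_code_of_entry hυ (hΞ x))
        (α := υ'.erase) fun n => (hlow n _ (hυ n)).1.symm
      have hd (ρ n) (hρ : Holds E Φ' (push ρ n)) : ((υ n).den E.interp ρ).Def :=
        ModTy.def_iff.1 (hΞd n x _ (hυ n)) ρ (hΦ ρ n hρ)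
      have hdef : υ''.Def E Φ' := hΦ.ty_def (fun ρ n hd _ => (hden ρ n hd).1)
        fun n => hΞd n x _ (hυ n)
      obtain ⟨hγd, hδd⟩ := hsum.def hdef
      refine ⟨some γ'', some δ'', some υ'', .both hsum, ?_, ?_, ?_, fun _ => ⟨γ'', rfl, ?_⟩,
        ?_, fun _ => ⟨δ'', rfl, ?_⟩⟩
      · rw [Option.mem_def] at hυ'
        rw [hυ']
        refine .some (.of_den hυe.symm fun ρ hρ => ?_)
        obtain ⟨ρ, n, rfl⟩ := exists_push ρ
        rw [(hden ρ n (hd ρ n hρ)).1]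
        exact (hlow n _ (hυ n)).2 ρ hρ
      · rintro _ ⟨⟩; exact hdef
      · rintro _ ⟨⟩; exact hγd
      · intro n σ hσ
        refine ⟨by rw [hγe, hγe' n σ hσ], fun ρ hρ => ?_⟩
        rw [← (hden ρ n (hd ρ n hρ)).2.1 σ hσ]
        exact .refl (ModTy.def_iff.1 hγd _ hρ)
      · rintro _ ⟨⟩; exact hδd
      · intro n σ hσ
        refine ⟨by rw [hδe, hδe' n σ hσ], fun ρ hρ => ?_⟩
        rw [← (hden ρ n (hd ρ n hρ)).2.2 σ hσ]
        exact .refl (ModTy.def_iff.1 hδd _ hρ)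
    · push Not at hx
      obtain ⟨n, hn⟩ := hx
      have hnone : Γ n x = none ∧ Δ n x = none := by
        have := h n x
        generalize Γ n x = g, Δ n x = d, Ξ n x = u at this hn
        cases this <;> simp at hn ⊢
      -- A member whose sum lacks the variable lacks it in both summands, so neither side is under
      -- any demand and the declaration may go entirely to the left.
      refine ⟨Ξ' x, none, Ξ' x, ?_, ?_, hΞd' x, hΞd' x,
        fun h => by simpa [hnone.1] using h n, by simp, fun h => by simpa [hnone.2] using h n⟩
      · cases Ξ' x with
        | none => exact .none
        | some σ => exact .left σ
      · cases hx : Ξ' x with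
        | none => exact .none
        | some σ =>
          exact .some (.of_den rfl fun ρ hρ => .refl (ModTy.def_iff.1 (hΞd' x σ hx) ρ hρ))
  choose g d u hsum hsub hu hg hg' hd hd' using main
  exact ⟨g, d, u, hsum, hsub, hu, hg, hg', hd, hd'⟩

/-! ## Reading derivations -/

/-- The type of the subject of a skeleton. -/
def Skeleton.pty : Skeleton → PTy
  | .var α | .num α | .lam α _ | .fix α _ | .app α _ _ | .succ α _ | .pred α _
  | .ifz α _ _ _ => α

namespace Deriv

variable {k n : ℕ} {Φ : ICtx S n} {Γ : Ctx S k n} {K : Index S n} {t : Term k} {τ : ModTy S n}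

/-- Field `0` of a code is the rule, field `1` the judgement, and the premises start at field `2`.
-/
theorem field_one_code (D : Deriv E Φ Γ K t τ) :
    field 1 D.code = codeNode 0 [k, n, Φ.code, Γ.code, K.code, t.code, τ.code] := by
  cases D <;> simp [code, codeStep, field_codeNode]

theorem WellDefined.judgDef {D : Deriv E Φ Γ K t τ} (h : D.WellDefined) : D.JudgDef := by
  cases D <;> first | exact h | exact h.1

/-- The derivation does not end with a subsumption. -/
def Proper : {k n : ℕ} → {Φ : ICtx S n} → {Γ : Ctx S k n} → {K : Index S n} → {t : Term k} →
    {τ : ModTy S n} → Deriv E Φ Γ K t τ → Prop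
  | _, _, _, _, _, _, _, .subs _ _ _ _ => False
  | _, _, _, _, _, _, _, _ => True

/-- The code of the premise, if `c` codes a derivation which ends with a subsumption. -/
def stripStep (c : ℕ) : ℕ := if field 0 c = 1 then field 2 c else c

/-- The code of the derivation without its final subsumptions. -/
def stripCode (c : ℕ) : ℕ := stripStep^[c] c

theorem primrec_stripCode : Primrec stripCode := by
  have h : Primrec stripStep := Primrec.ite
    (Primrec.eq.comp (primrec₂_field.comp (Primrec.const 0) Primrec.id) (Primrec.const 1))
    (primrec₂_field.comp (Primrec.const 2) Primrec.id) Primrec.id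
  exact Primrec.nat_iterate Primrec.id Primrec.id (h.comp Primrec.snd)

theorem stripStep_code_of_proper {D : Deriv E Φ Γ K t τ} (h : D.Proper) :
    stripStep D.code = D.code := by
  cases D <;> first | exact h.elim | simp [stripStep, code, codeStep, field_codeNode]

theorem code_lt_codeNode (l x c : ℕ) : c < codeNode l [x, c] := by
  have h₁ (a : ℕ) (l : List ℕ) :
      Encodable.encode (a :: l) = Nat.succ (Nat.pair a (Encodable.encode l)) := rfl
  have h₂ (a : ℕ) (l : List ℕ) : a < Encodable.encode (a :: l) := by
    rw [h₁]; exact Nat.lt_succ_of_le (Nat.left_le_pair _ _)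
  have h₃ (a : ℕ) (l : List ℕ) : Encodable.encode l < Encodable.encode (a :: l) := by
    rw [h₁]; exact Nat.lt_succ_of_le (Nat.right_le_pair _ _)
  exact (h₂ c []).trans ((h₃ x _).trans (h₃ l _))

/-- Consecutive subsumptions compose, by transitivity of the pointwise meaning. Each of them
strictly increases the code, so the code itself bounds the number of iterations of `stripStep`,
which fixes codes of proper derivations. This makes the removal computable although the number of
subsumptions varies with the derivation. -/
theorem exists_proper (D : Deriv E Φ Γ K t τ) (h : D.WellDefined) :
    ∃ (Γ₁ : Ctx S k n) (K₁ : Index S n) (τ₁ : ModTy S n) (D₁ : Deriv E Φ Γ₁ K₁ t τ₁),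
      D₁.Proper ∧ D₁.WellDefined ∧ D₁.skeleton = D.skeleton ∧
      (∀ x, Option.Rel (DlPCF.Sub E Φ) (Γ x) (Γ₁ x)) ∧
      DlPCF.Sub E Φ τ₁ τ ∧ Le E Φ K₁ K ∧ ∀ m, D.code ≤ m → stripStep^[m] D.code = D₁.code := by
  have refl {k n : ℕ} {Φ : ICtx S n} {Γ : Ctx S k n} {K : Index S n} {t : Term k}
      {τ : ModTy S n} (D : Deriv E Φ Γ K t τ) (h : D.WellDefined) (hp : D.Proper) :
      ∃ (Γ₁ : Ctx S k n) (K₁ : Index S n) (τ₁ : ModTy S n) (D₁ : Deriv E Φ Γ₁ K₁ t τ₁),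
      D₁.Proper ∧ D₁.WellDefined ∧ D₁.skeleton = D.skeleton ∧
      (∀ x, Option.Rel (DlPCF.Sub E Φ) (Γ x) (Γ₁ x)) ∧
      DlPCF.Sub E Φ τ₁ τ ∧ Le E Φ K₁ K ∧
      ∀ m, D.code ≤ m → stripStep^[m] D.code = D₁.code := by
    obtain ⟨hΓ, hK, hτ⟩ := h.judgDef
    refine ⟨Γ, K, τ, D, hp, h, rfl, fun x => ?_, .of_den rfl fun ρ hρ =>
      .refl (ModTy.def_iff.1 hτ ρ hρ), hK,
      fun m _ => Function.iterate_fixed (stripStep_code_of_proper hp) m⟩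
    cases hx : Γ x with
    | none => exact .none
    | some σ =>
      exact .some (.of_den rfl fun ρ hρ => .refl (ModTy.def_iff.1 (hΓ x σ hx) ρ hρ))
  induction D with
  | @subs _ _ _ Γ₀ Δ₀ _ _ _ _ _ d hctx hty hw ih =>
    obtain ⟨Γ₁, K₁, τ₁, D₁, hp, hd, hs, hΓ, hτ, hK, hc⟩ := ih h.2
    refine ⟨Γ₁, K₁, τ₁, D₁, hp, hd, hs, fun x => ?_, ?_, ?_, fun m hm => ?_⟩
    · have h₁ := hctx x
      have h₂ := hΓ x
      generalize Δ₀ x = a, Γ₀ x = b, Γ₁ x = c at h₁ h₂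
      cases h₁ with
      | none => exact h₂
      | some h₁ =>
        cases h₂ with
        | some h₂ =>
          exact .some (.of_den (h₁.erase_eq.trans h₂.erase_eq)
            fun ρ hρ => (h₁.den hρ).trans (h₂.den hρ))
    · exact .of_den (hτ.erase_eq.trans hty.erase_eq)
        fun ρ hρ => (hτ.den hρ).trans (hty.den hρ)
    · exact fun ρ hρ => PLe.trans (hK ρ hρ) (hw ρ hρ)
    · have hlt : d.code < (Deriv.subs d hctx hty hw).code := code_lt_codeNode _ _ _
      obtain ⟨m, rfl⟩ : ∃ m', m = m' + 1 := ⟨m - 1, by omega⟩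
      rw [Function.iterate_succ_apply, ← hc m (by omega)]
      congr 1
      simp [stripStep, code, codeStep, field_codeNode]
  | _ => exact refl _ h trivial

theorem skeleton_pty (D : Deriv E Φ Γ K t τ) : D.skeleton.pty = τ.erase := by
  induction D with
  | subs d hctx hty hw ih => exact ih.trans hty.erase_eq
  | _ => rfl

end Deriv

section Computable

variable {k p : ℕ} {Φ : ℕ → ICtx S p} {Γ : ℕ → Ctx S k p} {K : ℕ → Index S p} {t : Term k}
  {τ : ℕ → ModTy S p} {D : ∀ n, Deriv E (Φ n) (Γ n) (K n) t (τ n)}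

theorem computable_type_code (h : Computable fun n => (D n).code) :
    Computable fun n => (τ n).code :=
  (computable_field 7 (computable_field 1 h)).of_eq fun n => by
    simp [Deriv.field_one_code, field_codeNode]

theorem computable_weight_code (h : Computable fun n => (D n).code) :
    Computable fun n => (K n).code :=
  (computable_field 5 (computable_field 1 h)).of_eq fun n => by
    simp [Deriv.field_one_code, field_codeNode]

theorem computable_entryCode (h : Computable fun n => (D n).code) (x : Fin k) :
    Computable fun n => entryCode (Γ n x) :=
  (computable_field x (computable_field 4 (computable_field 1 h))).of_eq fun n => by
    rw [Deriv.field_one_code, field_codeNode]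
    simp [field, Ctx.code, fields_encode, entryCode]

end Computable

/-! ## Families of derivations -/

/-- A computable family of well-defined derivations with a common subject and skeleton. -/
structure Family (E : EqProgram S) {k : ℕ} (p : ℕ) (t : Term k) where
  Φ : ℕ → ICtx S p
  Γ : ℕ → Ctx S k p
  K : ℕ → Index S p
  τ : ℕ → ModTy S p
  D : ∀ n, Deriv E (Φ n) (Γ n) (K n) t (τ n)
  wellDefined : ∀ n, (D n).WellDefined
  computable : Computable fun n => (D n).code
  skeleton_eq : ∀ m n, (D m).skeleton = (D n).skeleton

theorem Family.erase_eq {k p : ℕ} {t : Term k} (F : Family E p t) (m n : ℕ) :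
    (F.τ m).erase = (F.τ n).erase := by
  rw [← (F.D m).skeleton_pty, ← (F.D n).skeleton_pty, F.skeleton_eq m n]

/-- A judgement which is weaker than all members of a family. -/
structure Family.Target {k p : ℕ} {t : Term k} (F : Family E p t) (Φ' : ICtx S (p + 1))
    (Γ' : Ctx S k (p + 1)) (K' : Index S (p + 1)) (τ' : ModTy S (p + 1)) : Prop where
  implies : Implies E Φ' F.Φ
  ctx : CtxBelow E Φ' Γ' F.Γ
  ctx_def : Γ'.Def E Φ'
  weight : ∀ ρ n, Holds E Φ' (push ρ n) →
    PLe ((F.K n).eval E.interp ρ) (K'.eval E.interp (push ρ n))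
  erase_eq : ∀ n, (F.τ n).erase = τ'.erase
  ty : ∀ ρ n, Holds E Φ' (push ρ n) →
    ESub ((F.τ n).den E.interp ρ) (τ'.den E.interp (push ρ n))
  ty_def : τ'.Def E Φ'

def Derivable (E : EqProgram S) {k n : ℕ} (Φ : ICtx S n) (Γ : Ctx S k n) (K : Index S n)
    (t : Term k) (τ : ModTy S n) : Prop :=
  ∃ D : Deriv E Φ Γ K t τ, D.WellDefined

/-- Every judgement weaker than all members of a family for `t` is derivable. -/
def Uniformisable (E : EqProgram S) {k : ℕ} (t : Term k) : Prop :=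
  ∀ {p : ℕ} (F : Family E p t) {Φ' : ICtx S (p + 1)} {Γ' : Ctx S k (p + 1)}
    {K' : Index S (p + 1)} {τ' : ModTy S (p + 1)}, F.Target Φ' Γ' K' τ' →
    Derivable E Φ' Γ' K' t τ'

/-- The stripped derivations have larger contexts and smaller types and weights in the sense of
subsumption, so a judgement weaker than the original members is weaker than the stripped ones. -/
theorem Uniformisable.of_proper {k : ℕ} {t : Term k}
    (H : ∀ {p : ℕ} (F : Family E p t) {Φ' : ICtx S (p + 1)} {Γ' : Ctx S k (p + 1)}
      {K' : Index S (p + 1)} {τ' : ModTy S (p + 1)}, (∀ n, (F.D n).Proper) →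
      F.Target Φ' Γ' K' τ' → Derivable E Φ' Γ' K' t τ') : Uniformisable E t := by
  intro p F Φ' Γ' K' τ' T
  choose Γ K τ D hp hd hs hΓ hτ hK hc using fun n => (F.D n).exists_proper (F.wellDefined n)
  let F₁ : Family E p t := ⟨F.Φ, Γ, K, τ, D, hd,
    (Deriv.primrec_stripCode.to_comp.comp F.computable).of_eq fun n => hc n _ le_rfl,
    fun m n => by rw [hs, hs, F.skeleton_eq m n]⟩
  refine H F₁ hp ⟨T.implies, fun x hx => ?_, T.ctx_def, fun ρ n hρ => ?_, fun n => ?_,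
    fun ρ n hρ => ?_, T.ty_def⟩
  · have hx' : ∀ n σ, Γ n x = some σ → ∃ σ₀, F.Γ n x = some σ₀ ∧ Sub E (F.Φ n) σ₀ σ := by
      intro n σ hσ
      have := hΓ n x
      rw [hσ] at this
      generalize F.Γ n x = a at this
      cases this with | some h => exact ⟨_, rfl, h⟩
    obtain ⟨σ', hσ', hlow⟩ := T.ctx x fun n => by
      obtain ⟨σ, hσ⟩ := Option.isSome_iff_exists.1 (hx n)
      obtain ⟨σ₀, h, -⟩ := hx' n σ hσ
      simp [h]
    refine ⟨σ', hσ', fun n σ hσ => ?_⟩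
    obtain ⟨σ₀, h, hsub⟩ := hx' n σ hσ
    exact ⟨(hlow n σ₀ h).1.trans hsub.erase_eq,
      fun ρ hρ => ((hlow n σ₀ h).2 ρ hρ).trans (hsub.den (T.implies ρ n hρ))⟩
  · exact PLe.trans (hK n ρ (T.implies ρ n hρ)) (T.weight ρ n hρ)
  · exact (hτ n).erase_eq.trans (T.erase_eq n)
  · exact ((hτ n).den (T.implies ρ n hρ)).trans (T.ty ρ n hρ)

theorem Derivable.subs {k n : ℕ} {Φ : ICtx S n} {Γ Δ : Ctx S k n} {I J : Index S n}
    {t : Term k} {σ τ : ModTy S n} (h : Derivable E Φ Γ I t σ) (hctx : Ctx.Sub E Φ Δ Γ)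
    (hΔ : Δ.Def E Φ) (hw : Le E Φ I J) (hty : Sub E Φ σ τ) (hτ : τ.Def E Φ) :
    Derivable E Φ Δ J t τ := by
  obtain ⟨D, hD⟩ := h
  refine ⟨.subs D hctx hty hw, ⟨hΔ, def_iff.2 fun ρ hρ => PLe.dom_right (hw ρ hρ), hτ⟩, hD⟩

theorem Ctx.Def.sub_refl {k n : ℕ} {Φ : ICtx S n} {Γ : Ctx S k n} (h : Γ.Def E Φ) :
    Ctx.Sub E Φ Γ Γ := by
  intro x
  cases hx : Γ x with
  | none => exact .none
  | some σ => exact .some (.of_den rfl fun ρ hρ => .refl (ModTy.def_iff.1 (h x σ hx) ρ hρ))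

theorem ESub.of_eq {X Y : ETy} (h : X = Y) (hY : Y.Def) : ESub X Y ∧ X.Def := by
  subst h
  exact ⟨.refl hY, hY⟩

/-- This serves the type of a fixpoint, whose components are known to agree only below the bound,
where the forests involved are finite. -/
theorem ESub.of_eqOn {I I' : Part ℕ} {σ τ σ' τ' : ℕ → ETy} (hI : I' = I)
    (h : ∀ a, PLt a I → σ' a = σ a ∧ τ' a = τ a) (hd : (ETy.bang I σ τ).Def) :
    ESub (.bang I' σ' τ') (.bang I σ τ) ∧ (ETy.bang I' σ' τ').Def := by
  subst hI
  refine ⟨.bang (fun a ha => ?_) (fun a ha => ?_) (.refl hd.1), hd.1, fun a ha => ?_⟩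
  · rw [(h a ha).1]; exact .refl (hd.2 a ha).1
  · rw [(h a ha).2]; exact .refl (hd.2 a ha).2
  · rw [(h a ha).1, (h a ha).2]; exact hd.2 a ha

theorem TyBelow.of_eq {p : ℕ} {Φ' : ICtx S (p + 1)} {σ' : ModTy S (p + 1)} {n : ℕ}
    {σ : ModTy S p} (hd : σ'.Def E Φ') (he : σ'.erase = σ.erase)
    (h : ∀ ρ, σ'.den E.interp (push ρ n) = σ.den E.interp ρ) : TyBelow E Φ' σ' n σ :=
  ⟨he, fun ρ hρ => h ρ ▸ .refl (ModTy.def_iff.1 hd _ hρ)⟩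

/-- It suffices to derive a judgement with the same weight and type as the members of the
family. -/
theorem Family.Target.derivable {k p : ℕ} {t : Term k} {F : Family E p t}
    {Φ' : ICtx S (p + 1)} {Γ' Γ'' : Ctx S k (p + 1)} {K' K'' : Index S (p + 1)}
    {τ' τ'' : ModTy S (p + 1)} (T : F.Target Φ' Γ' K' τ')
    (hctx : Ctx.Sub E Φ' Γ' Γ'')
    (hK : ∀ ρ n, Holds E Φ' (push ρ n) →
      K''.eval E.interp (push ρ n) = (F.K n).eval E.interp ρ)
    (he : ∀ n, τ''.erase = (F.τ n).erase)
    (hτ : ∀ ρ n, ((F.τ n).den E.interp ρ).Def → Holds E Φ' (push ρ n) →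
      ESub (τ''.den E.interp (push ρ n)) ((F.τ n).den E.interp ρ) ∧
        (τ''.den E.interp (push ρ n)).Def)
    (h : DlPCF.Def E Φ' K'' → τ''.Def E Φ' → Derivable E Φ' Γ'' K'' t τ'') :
    Derivable E Φ' Γ' K' t τ' := by
  have hd n := (F.wellDefined n).judgDef
  have hw : Le E Φ' K'' K' := fun ρ hρ => by
    obtain ⟨ρ, n, rfl⟩ := exists_push ρ
    change PLe (K''.eval _ _) _
    rw [hK ρ n hρ]
    exact T.weight ρ n hρ
  have hty : Sub E Φ' τ'' τ' := .of_den ((he 0).trans (T.erase_eq 0)) fun ρ hρ => by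
    obtain ⟨ρ, n, rfl⟩ := exists_push ρ
    exact (hτ ρ n (ModTy.def_iff.1 (hd n).2.2 ρ (T.implies ρ n hρ)) hρ).1.trans (T.ty ρ n hρ)
  refine (h (def_iff.2 fun ρ hρ => PLe.dom_left (hw ρ hρ)) ?_).subs hctx T.ctx_def hw hty T.ty_def
  refine ModTy.def_iff.2 fun ρ hρ => ?_
  obtain ⟨ρ, n, rfl⟩ := exists_push ρ
  exact (hτ ρ n (ModTy.def_iff.1 (hd n).2.2 ρ (T.implies ρ n hρ)) hρ).2

/-- A judgement whose weight and type are the uniformisations of those of the members of the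
family. -/
theorem Family.target {k p : ℕ} {t : Term k} (F : Family E p t) {Φ' : ICtx S (p + 1)}
    {Γ' : Ctx S k (p + 1)} {K' : Index S (p + 1)} {τ' : ModTy S (p + 1)}
    (hΦ : Implies E Φ' F.Φ) (hctx : CtxBelow E Φ' Γ' F.Γ) (hΓ : Γ'.Def E Φ')
    (hK : Uniform E K' F.K) (he : ∀ n, τ'.erase = (F.τ n).erase)
    (hτ : ∀ ρ n, τ'.den E.interp (push ρ n) = (F.τ n).den E.interp ρ) :
    F.Target Φ' Γ' K' τ' := by
  have hd n := (F.wellDefined n).judgDef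
  refine ⟨hΦ, hctx, hΓ, fun ρ n hρ => ?_, fun n => (he n).symm, fun ρ n hρ => ?_,
    hΦ.ty_def (fun ρ n _ _ => hτ ρ n) fun n => (hd n).2.2⟩
  · rw [hK]
    exact .refl (def_iff.1 (hd n).2.1 ρ (hΦ ρ n hρ))
  · rw [hτ]
    exact .refl (ModTy.def_iff.1 (hd n).2.2 ρ (hΦ ρ n hρ))

/-! ## Inversion of the typing rules -/

namespace Deriv.Proper

variable {k n : ℕ} {Φ : ICtx S n} {Δ : Ctx S k n} {W : Index S n} {τ₀ : ModTy S n}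

theorem inv_var {x : Fin k} {D : Deriv E Φ Δ W (.var x) τ₀} (hp : D.Proper) :
    Δ x = some τ₀ := by
  cases D with
  | subs => exact hp.elim
  | ax h => exact h

theorem inv_num {m : ℕ} {D : Deriv E Φ Δ W (.num m : Term k) τ₀} (hp : D.Proper) :
    W = .zero ∧ τ₀ = .nat (.numeral m) (.numeral m) := by
  cases D with
  | subs => exact hp.elim
  | num => exact ⟨rfl, rfl⟩

theorem inv_succ {t : Term k} {D : Deriv E Φ Δ W (.succ t) τ₀} (hp : D.Proper)
    (hd : D.WellDefined) : ∃ (I J : Index S n) (d : Deriv E Φ Δ W t (.nat I J)),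
      τ₀ = .nat (.add I .one) (.add J .one) ∧ d.WellDefined ∧
      D.skeleton = .succ τ₀.erase d.skeleton ∧ d.code = field 2 D.code := by
  cases D with
  | subs => exact hp.elim
  | succ d =>
    exact ⟨_, _, d, rfl, hd.2, rfl, by simp [code, codeStep, field_codeNode]⟩

theorem inv_pred {t : Term k} {D : Deriv E Φ Δ W (.pred t) τ₀} (hp : D.Proper)
    (hd : D.WellDefined) : ∃ (I J : Index S n) (d : Deriv E Φ Δ W t (.nat I J)),
      τ₀ = .nat (.monus I .one) (.monus J .one) ∧ d.WellDefined ∧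
      D.skeleton = .pred τ₀.erase d.skeleton ∧ d.code = field 2 D.code := by
  cases D with
  | subs => exact hp.elim
  | pred d =>
    exact ⟨_, _, d, rfl, hd.2, rfl, by simp [code, codeStep, field_codeNode]⟩

theorem inv_lam {t : Term (k + 1)} {D : Deriv E Φ Δ W (.lam t) τ₀} (hp : D.Proper)
    (hd : D.WellDefined) : ∃ (I : Index S n) (Γ : Ctx S k (n + 1)) (K : Index S (n + 1))
      (σ τ : ModTy S (n + 1)) (d : Deriv E (Φ.below I) (Γ.snoc σ) K t τ),
      Ctx.BSum I Γ Δ ∧ W = .add I (.bsum I K) ∧ τ₀ = .bang I σ τ ∧ d.WellDefined ∧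
      D.skeleton = .lam τ₀.erase d.skeleton ∧ d.code = field 2 D.code := by
  cases D with
  | subs => exact hp.elim
  | lam d hΔ =>
    exact ⟨_, _, _, _, _, d, hΔ, rfl, rfl, hd.2, rfl, by simp [code, codeStep, field_codeNode]⟩

theorem inv_app {t u : Term k} {D : Deriv E Φ Δ W (.app t u) τ₀} (hp : D.Proper)
    (hd : D.WellDefined) : ∃ (Γ₁ Γ₂ : Ctx S k n) (K H : Index S n) (σ τ : ModTy S (n + 1))
      (d : Deriv E Φ Γ₁ K t (.bang .one σ τ)) (e : Deriv E Φ Γ₂ H u (σ.inst .zero)),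
      Ctx.Sum Γ₁ Γ₂ Δ ∧ W = .add K H ∧ τ₀ = τ.inst .zero ∧ d.WellDefined ∧ e.WellDefined ∧
      D.skeleton = .app τ₀.erase d.skeleton e.skeleton ∧ d.code = field 2 D.code ∧
      e.code = field 3 D.code := by
  cases D with
  | subs => exact hp.elim
  | app d e hΞ =>
    exact ⟨_, _, _, _, _, _, d, e, hΞ, rfl, rfl, hd.2.1, hd.2.2, rfl,
      by simp [code, codeStep, field_codeNode], by simp [code, codeStep, field_codeNode]⟩

theorem inv_ifz {t u s : Term k} {D : Deriv E Φ Δ W (.ifz t u s) τ₀} (hp : D.Proper)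
    (hd : D.WellDefined) : ∃ (Γ₁ Γ₂ : Ctx S k n) (M N J K : Index S n)
      (d : Deriv E Φ Γ₁ M t (.nat J K)) (e₀ : Deriv E (⟨J, .zero⟩ :: Φ) Γ₂ N u τ₀)
      (e₁ : Deriv E (⟨.one, K⟩ :: Φ) Γ₂ N s τ₀),
      Ctx.Sum Γ₁ Γ₂ Δ ∧ W = .add M N ∧ d.WellDefined ∧ e₀.WellDefined ∧ e₁.WellDefined ∧
      D.skeleton = .ifz τ₀.erase d.skeleton e₀.skeleton e₁.skeleton ∧
      d.code = field 2 D.code ∧ e₀.code = field 3 D.code ∧ e₁.code = field 4 D.code := by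
  cases D with
  | subs => exact hp.elim
  | ifz d e₀ e₁ hΞ =>
    exact ⟨_, _, _, _, _, _, d, e₀, e₁, hΞ, rfl, hd.2.1, hd.2.2.1, hd.2.2.2, rfl,
      by simp [code, codeStep, field_codeNode], by simp [code, codeStep, field_codeNode],
      by simp [code, codeStep, field_codeNode]⟩

end Deriv.Proper

/-- The substitution of the index of the `a`-th child of the node `b`. -/
def subtreeSubst {n : ℕ} (I : Index S (n + 1)) : Fin (n + 1) → Index S (n + 2) :=
  Fin.cases
    (.add
      (.add
        (.fcard (.add (.var 1) .one) (.var 0)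
          (I.rename (Fin.cases 0 fun i => i.succ.succ.succ)))
        (.var 1))
      .one)
    fun i => .var i.succ.succ

/-- The substitution of the index of the `a`-th root. -/
def treeSubst {n : ℕ} (I : Index S (n + 1)) : Fin (n + 1) → Index S (n + 1) :=
  Fin.cases (.fcard .zero (.var 0) (I.rename (Fin.cases 0 fun i => i.succ.succ)))
    fun i => .var i.succ

theorem Deriv.Proper.inv_fix {k n : ℕ} {Φ : ICtx S n} {Δ : Ctx S k n} {W : Index S n}
    {τ₀ : ModTy S n} {t : Term (k + 1)} {D : Deriv E Φ Δ W (.fix t) τ₀} (hp : D.Proper)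
    (hd : D.WellDefined) : ∃ (Γ : Ctx S k (n + 1)) (K : Index S n) (I J : Index S (n + 1))
      (A B : LinTy S (n + 2))
      (d : Deriv E (Φ.below (.fcard .zero K I)) (Γ.snoc (.modal I A)) J t (.modal .one B)),
      SubLin E ((Φ.below (.fcard .zero K I)).below I)
        ((B.inst .zero).subst (subtreeSubst I)) A ∧
      Ctx.BSum (.fcard .zero K I) Γ Δ ∧
      W = .add (.fcard .zero K I) (.bsum (.fcard .zero K I) J) ∧
      τ₀ = .modal K ((B.inst .zero).subst (treeSubst I)) ∧ d.WellDefined ∧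
      D.skeleton = .fix τ₀.erase d.skeleton ∧ d.code = field 2 D.code := by
  cases D with
  | subs => exact hp.elim
  | fix hH d hsub hΔ =>
    subst hH
    exact ⟨_, _, _, _, _, _, d, hsub, hΔ, rfl, rfl, hd.2, rfl,
      by simp [code, codeStep, field_codeNode]⟩

/-! ## Uniformisation, rule by rule -/

/-- The variable is declared in all members, so the context of the target declares it with a common
subtype; an axiom followed by subsumption suffices. -/
theorem uniformisable_var {k : ℕ} (x : Fin k) : Uniformisable E (.var x : Term k) := by
  refine Uniformisable.of_proper fun {p} F {Φ' Γ' K' τ'} hp T => ?_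
  have hx n := (hp n).inv_var
  obtain ⟨σ', hσ', hlow⟩ := T.ctx x fun n => by simp [hx n]
  have hσd := T.ctx_def x σ' hσ'
  have h : Derivable E Φ' Γ' .zero (.var x) σ' :=
    ⟨.ax hσ', T.ctx_def, def_iff.2 fun _ _ => trivial, hσd⟩
  refine h.subs T.ctx_def.sub_refl T.ctx_def (fun ρ hρ => ?_)
    (.of_den ((hlow 0 _ (hx 0)).1.trans (T.erase_eq 0)) fun ρ hρ => ?_) T.ty_def
  · obtain ⟨ρ, n, rfl⟩ := exists_push ρ
    exact zero_PLe (T.weight ρ n hρ).dom_right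
  · obtain ⟨ρ, n, rfl⟩ := exists_push ρ
    exact ((hlow n _ (hx n)).2 ρ hρ).trans (T.ty ρ n hρ)

theorem uniformisable_num {k : ℕ} (m : ℕ) : Uniformisable E (.num m : Term k) := by
  refine Uniformisable.of_proper fun {p} F {Φ' Γ' K' τ'} hp T => ?_
  have hK n := (hp n).inv_num.1
  have hτ n := (hp n).inv_num.2
  refine T.derivable (K'' := .zero) (τ'' := .nat (.numeral m) (.numeral m)) T.ctx_def.sub_refl
    (fun ρ n _ => ?_) (fun n => ?_) (fun ρ n hd _ => ESub.of_eq ?_ hd)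
    fun hKd hτd => ⟨.num m, T.ctx_def, hKd, hτd⟩
  · rw [hK]; rfl
  · rw [hτ]; rfl
  · simp only [hτ, ModTy.den, Index.eval_numeral]

theorem uniformisable_succ (hE : E.Universal) {k : ℕ} {t : Term k} (ih : Uniformisable E t) :
    Uniformisable E t.succ := by
  refine Uniformisable.of_proper fun {p} F {Φ' Γ' K' τ'} hp T => ?_
  choose I J d hτ hd hs hc using fun n => (hp n).inv_succ (F.wellDefined n)
  let F₁ : Family E p t := ⟨F.Φ, F.Γ, F.K, _, d, hd,
    (computable_field 2 F.computable).of_eq fun n => (hc n).symm,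
    fun m n => (Skeleton.succ.inj ((hs m).symm.trans ((F.skeleton_eq m n).trans (hs n)))).2⟩
  have hty := computable_type_code F₁.computable
  obtain ⟨I', hI⟩ := hE.exists_index (I := I) ((computable_field 1 hty).of_eq fun n => by
    simp [F₁, ModTy.code, field_codeNode])
  obtain ⟨J', hJ⟩ := hE.exists_index (I := J) ((computable_field 2 hty).of_eq fun n => by
    simp [F₁, ModTy.code, field_codeNode])
  obtain ⟨K'', hK⟩ := hE.exists_index (computable_weight_code F.computable)
  obtain ⟨D, hD⟩ := ih F₁ (F₁.target (K' := K'') (τ' := .nat I' J') T.implies T.ctx T.ctx_def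
    hK (fun _ => rfl) fun ρ n => by simp only [F₁, ModTy.den, hI, hJ])
  refine T.derivable T.ctx_def.sub_refl (fun ρ n _ => hK ρ n) (fun n => ?_)
    (fun ρ n hd _ => ESub.of_eq ?_ hd) fun hKd hτd => ⟨.succ D, ⟨T.ctx_def, hKd, hτd⟩, hD⟩
  · rw [hτ]; rfl
  · simp only [hτ, ModTy.den, Index.eval, hI, hJ]

theorem uniformisable_pred (hE : E.Universal) {k : ℕ} {t : Term k} (ih : Uniformisable E t) :
    Uniformisable E t.pred := by
  refine Uniformisable.of_proper fun {p} F {Φ' Γ' K' τ'} hp T => ?_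
  choose I J d hτ hd hs hc using fun n => (hp n).inv_pred (F.wellDefined n)
  let F₁ : Family E p t := ⟨F.Φ, F.Γ, F.K, _, d, hd,
    (computable_field 2 F.computable).of_eq fun n => (hc n).symm,
    fun m n => (Skeleton.pred.inj ((hs m).symm.trans ((F.skeleton_eq m n).trans (hs n)))).2⟩
  have hty := computable_type_code F₁.computable
  obtain ⟨I', hI⟩ := hE.exists_index (I := I) ((computable_field 1 hty).of_eq fun n => by
    simp [F₁, ModTy.code, field_codeNode])
  obtain ⟨J', hJ⟩ := hE.exists_index (I := J) ((computable_field 2 hty).of_eq fun n => by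
    simp [F₁, ModTy.code, field_codeNode])
  obtain ⟨K'', hK⟩ := hE.exists_index (computable_weight_code F.computable)
  obtain ⟨D, hD⟩ := ih F₁ (F₁.target (K' := K'') (τ' := .nat I' J') T.implies T.ctx T.ctx_def
    hK (fun _ => rfl) fun ρ n => by simp only [F₁, ModTy.den, hI, hJ])
  refine T.derivable T.ctx_def.sub_refl (fun ρ n _ => hK ρ n) (fun n => ?_)
    (fun ρ n hd _ => ESub.of_eq ?_ hd) fun hKd hτd => ⟨.pred D, ⟨T.ctx_def, hKd, hτd⟩, hD⟩
  · rw [hτ]; rfl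
  · simp only [hτ, ModTy.den, Index.eval, hI, hJ]

/-- The premises form a family over one more index variable, with constraints `a < I n`. The bound
variable receives the exact uniformisation of its types, and the remaining context comes from the
reconstructed bounded sum. -/
theorem uniformisable_lam (hE : E.Universal) {k : ℕ} {t : Term (k + 1)}
    (ih : Uniformisable E t) : Uniformisable E t.lam := by
  refine Uniformisable.of_proper fun {p} F {Φ' Γ' K' τ'} hp T => ?_
  choose I Γ K σ τ d hsum hW hτ hd hs hc using fun n => (hp n).inv_lam (F.wellDefined n)
  have hj n := (F.wellDefined n).judgDef
  let F₁ : Family E (p + 1) t := ⟨_, _, K, τ, d, hd,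
    (computable_field 2 F.computable).of_eq fun n => (hc n).symm,
    fun m n => (Skeleton.lam.inj ((hs m).symm.trans ((F.skeleton_eq m n).trans (hs n)))).2⟩
  have hty := computable_type_code F.computable
  have he n : (σ n).erase = (σ 0).erase ∧ (τ n).erase = (τ 0).erase := by
    simpa [hτ, ModTy.erase] using F.erase_eq n 0
  obtain ⟨I', hI⟩ := hE.exists_index (I := I) ((computable_field 1 hty).of_eq fun n => by
    simp [hτ n, ModTy.code, field_codeNode])
  obtain ⟨σ', hσe, hσ⟩ := hE.exists_type (σ := σ) ((computable_field 2 hty).of_eq fun n => by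
    simp [hτ n, ModTy.code, field_codeNode]) fun n => (he n).1
  obtain ⟨υ', hυe, hυ⟩ := hE.exists_type (σ := τ) (computable_type_code F₁.computable)
    fun n => (he n).2
  obtain ⟨K'', hK⟩ := hE.exists_index (I := K) (computable_weight_code F₁.computable)
  have hId : DlPCF.Def E Φ' I' := T.implies.def hI fun n => by
    have := (hj n).2.2
    rw [hτ n] at this
    exact this.1
  obtain ⟨Γ'', Δ'', hsum'', hsub, hΔd, hΓd, hlow⟩ := hE.exists_ctx_bsum T.implies hI hId hsum
    (fun x => (computable_entryCode F₁.computable x.succ).of_eq fun n => by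
      simp [F₁, Ctx.snoc])
    (computable_entryCode F.computable) (fun n => (hj n).1) T.ctx T.ctx_def
  refine T.derivable (K'' := .add I' (.bsum I' K'')) (τ'' := .bang I' σ' υ') hsub
    (fun ρ n _ => ?_) (fun n => ?_) (fun ρ n hd _ => ESub.of_eq ?_ hd) fun hKd hτd => ?_
  · exact hW n ▸ (Uniform.add hI (Uniform.bsum hI hK)) ρ n
  · simp only [hτ, ModTy.erase, hσe, hυe, he n]
  · simp only [hτ, ModTy.den, hI ρ n, cons_push, hσ _ n, hυ _ n]
  · obtain ⟨D, hD⟩ := ih F₁ (F₁.target (T.implies.below hI)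
      (hlow.snoc fun n => .of_eq hτd.2.1 (by rw [hσe, (he n).1]) fun ρ => hσ ρ n)
      (hΓd.snoc hτd.2.1) hK (fun n => by rw [hυe]; exact (he n).2.symm) hυ)
    exact ⟨.lam D hsum'', ⟨hΔd, hKd, hτd⟩, hD⟩

theorem uniformisable_app (hE : E.Universal) {k : ℕ} {t u : Term k} (iht : Uniformisable E t)
    (ihu : Uniformisable E u) : Uniformisable E (t.app u) := by
  refine Uniformisable.of_proper fun {p} F {Φ' Γ' K' τ'} hp T => ?_
  choose Γ Δ K H σ τ d e hsum hW hτ hd he hs hcd hce using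
    fun n => (hp n).inv_app (F.wellDefined n)
  have hj n := (F.wellDefined n).judgDef
  have hs' m n := Skeleton.app.inj ((hs m).symm.trans ((F.skeleton_eq m n).trans (hs n)))
  let F₁ : Family E p t := ⟨F.Φ, Γ, K, _, d, hd,
    (computable_field 2 F.computable).of_eq fun n => (hcd n).symm, fun m n => (hs' m n).2.1⟩
  let F₂ : Family E p u := ⟨F.Φ, Δ, H, _, e, he,
    (computable_field 3 F.computable).of_eq fun n => (hce n).symm, fun m n => (hs' m n).2.2⟩
  have hty := computable_type_code F₁.computable
  -- The argument type is invisible in the conclusion; its common erasure comes from the skeletons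
  -- of the premises.
  have her n : (σ n).erase = (σ 0).erase ∧ (τ n).erase = (τ 0).erase := by
    simpa [F₁, ModTy.erase] using F₁.erase_eq n 0
  obtain ⟨σ', hσe, hσ⟩ := hE.exists_type (σ := σ) ((computable_field 2 hty).of_eq fun n => by
    simp [F₁, ModTy.code, field_codeNode]) fun n => (her n).1
  obtain ⟨υ', hυe, hυ⟩ := hE.exists_type (σ := τ) ((computable_field 3 hty).of_eq fun n => by
    simp [F₁, ModTy.code, field_codeNode]) fun n => (her n).2
  obtain ⟨K'', hK⟩ := hE.exists_index (I := K) (computable_weight_code F₁.computable)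
  obtain ⟨H'', hH⟩ := hE.exists_index (I := H) (computable_weight_code F₂.computable)
  obtain ⟨Γ'', Δ'', Ξ'', hsum'', hsub, hΞd, hΓd, hΓ, hΔd, hΔ⟩ := hE.exists_ctx_sum T.implies
    hsum (computable_entryCode F₁.computable) (computable_entryCode F₂.computable)
    (computable_entryCode F.computable) (fun n => (hj n).1) T.ctx T.ctx_def
  refine T.derivable (K'' := .add K'' H'') (τ'' := υ'.inst .zero) hsub
    (fun ρ n _ => ?_) (fun n => ?_) (fun ρ n hd _ => ESub.of_eq ?_ hd) fun hKd hτd => ?_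
  · exact hW n ▸ (Uniform.add hK hH) ρ n
  · rw [hτ, ModTy.erase_inst, ModTy.erase_inst, hυe, (her n).2]
  · rw [hτ, ModTy.den_inst_zero, ModTy.den_inst_zero, cons_push, hυ]
  · obtain ⟨D₁, hD₁⟩ := iht F₁ (F₁.target (τ' := .bang .one σ' υ') T.implies hΓ hΓd hK
      (fun n => by simp only [F₁, ModTy.erase, hσe, hυe, her n])
      fun ρ n => by simp only [F₁, ModTy.den, cons_push, hσ _ n, hυ _ n]; rfl)
    obtain ⟨D₂, hD₂⟩ := ihu F₂ (F₂.target (τ' := σ'.inst .zero) T.implies hΔ hΔd hH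
      (fun n => by simp only [F₂, ModTy.erase_inst, hσe, her n])
      fun ρ n => by simp only [F₂, ModTy.den_inst_zero, cons_push, hσ _ n])
    exact ⟨.app D₁ D₂ hsum'', ⟨hΞd, hKd, hτd⟩, hD₁, hD₂⟩

theorem uniformisable_ifz (hE : E.Universal) {k : ℕ} {t u s : Term k}
    (iht : Uniformisable E t) (ihu : Uniformisable E u) (ihs : Uniformisable E s) :
    Uniformisable E (t.ifz u s) := by
  refine Uniformisable.of_proper fun {p} F {Φ' Γ' K' τ'} hp T => ?_
  choose Γ Δ M N J K d e₀ e₁ hsum hW hd he₀ he₁ hs hcd hce₀ hce₁ using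
    fun n => (hp n).inv_ifz (F.wellDefined n)
  have hj n := (F.wellDefined n).judgDef
  have hs' m n := Skeleton.ifz.inj ((hs m).symm.trans ((F.skeleton_eq m n).trans (hs n)))
  let F₁ : Family E p t := ⟨F.Φ, Γ, M, _, d, hd,
    (computable_field 2 F.computable).of_eq fun n => (hcd n).symm, fun m n => (hs' m n).2.1⟩
  let F₂ : Family E p u := ⟨_, Δ, N, F.τ, e₀, he₀,
    (computable_field 3 F.computable).of_eq fun n => (hce₀ n).symm,
    fun m n => (hs' m n).2.2.1⟩
  let F₃ : Family E p s := ⟨_, Δ, N, F.τ, e₁, he₁,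
    (computable_field 4 F.computable).of_eq fun n => (hce₁ n).symm,
    fun m n => (hs' m n).2.2.2⟩
  have hty := computable_type_code F₁.computable
  obtain ⟨J', hJ⟩ := hE.exists_index (I := J) ((computable_field 1 hty).of_eq fun n => by
    simp [F₁, ModTy.code, field_codeNode])
  obtain ⟨L', hL⟩ := hE.exists_index (I := K) ((computable_field 2 hty).of_eq fun n => by
    simp [F₁, ModTy.code, field_codeNode])
  obtain ⟨υ', hυe, hυ⟩ := hE.exists_type (computable_type_code F.computable)
    fun n => F.erase_eq n 0
  obtain ⟨M'', hM⟩ := hE.exists_index (I := M) (computable_weight_code F₁.computable)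
  obtain ⟨N'', hN⟩ := hE.exists_index (I := N) (computable_weight_code F₂.computable)
  obtain ⟨Γ'', Δ'', Ξ'', hsum'', hsub, hΞd, hΓd, hΓ, hΔd, hΔ⟩ := hE.exists_ctx_sum T.implies
    hsum (computable_entryCode F₁.computable) (computable_entryCode F₂.computable)
    (computable_entryCode F.computable) (fun n => (hj n).1) T.ctx T.ctx_def
  have hυe' n : υ'.erase = (F.τ n).erase := by rw [hυe, F.erase_eq n 0]
  refine T.derivable (K'' := .add M'' N'') (τ'' := υ') hsub
    (fun ρ n _ => ?_) hυe' (fun ρ n hd _ => ESub.of_eq (hυ ρ n) hd) fun hKd hτd => ?_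
  · exact hW n ▸ (Uniform.add hM hN) ρ n
  -- The branches share the context `Δ''`, which was built under `Φ'` and is used under one more
  -- constraint.
  · have weaken (I I' : Index S (p + 1)) (ρ : Fin (p + 1) → ℕ)
        (h : Holds E (⟨I, I'⟩ :: Φ') ρ) : Holds E Φ' ρ := (holds_cons.1 h).2
    obtain ⟨D₁, hD₁⟩ := iht F₁ (F₁.target (τ' := .nat J' L') T.implies hΓ hΓd hM
      (fun _ => rfl) fun ρ n => by simp only [F₁, ModTy.den, hJ ρ n, hL ρ n])
    obtain ⟨D₂, hD₂⟩ := ihu F₂ (F₂.target (T.implies.cons (J' := .zero) hJ fun _ _ => rfl)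
      (hΔ.mono (weaken _ _)) (hΔd.mono (weaken _ _)) hN hυe' hυ)
    obtain ⟨D₃, hD₃⟩ := ihs F₃ (F₃.target (T.implies.cons (I' := .one) (fun _ _ => rfl) hL)
      (hΔ.mono (weaken _ _)) (hΔd.mono (weaken _ _)) hN hυe' hυ)
    exact ⟨.ifz D₁ D₂ D₃ hsum'', ⟨hΞd, hKd, hτd⟩, hD₁, hD₂, hD₃⟩

theorem mem_eval_fcard_zero {φ : Interp S} {n : ℕ} {K : Index S n} {I : Index S (n + 1)}
    {ρ : Fin n → ℕ} {z : ℕ} : z ∈ (Index.fcard .zero K I).eval φ ρ ↔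
      ∃ j ∈ K.eval φ ρ, Forest (fun v => I.eval φ (Fin.cons v ρ)) 0 j z := by
  simp [Index.eval, mem_forestCard]

/-- The children of the nodes of a finite forest are roots of finite forests. -/
theorem exists_children {φ : Interp S} {n : ℕ} {K : Index S n} {I : Index S (n + 1)}
    {ρ : Fin n → ℕ} {a b : ℕ} (hb : PLt b ((Index.fcard .zero K I).eval φ ρ))
    (ha : PLt a (I.eval φ (Fin.cons b ρ))) :
    ∃ y, Forest (fun v => I.eval φ (Fin.cons v ρ)) (b + 1) a y := by
  obtain ⟨x, hx, hb⟩ := hb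
  obtain ⟨j, -, hF⟩ := mem_eval_fcard_zero.1 hx
  obtain ⟨c, hc, y, hy⟩ := hF.exists_subforest (Nat.zero_le b) (by omega)
  obtain ⟨c', hc', ha⟩ := ha
  obtain rfl := Part.mem_unique hc hc'
  exact hy.exists_of_le ha.le

theorem exists_trees {φ : Interp S} {n : ℕ} {K : Index S n} {I : Index S (n + 1)}
    {ρ : Fin n → ℕ} {a : ℕ} (hd : ((Index.fcard .zero K I).eval φ ρ).Dom)
    (ha : PLt a (K.eval φ ρ)) : ∃ y, Forest (fun v => I.eval φ (Fin.cons v ρ)) 0 a y := by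
  obtain ⟨x, hx⟩ := Part.dom_iff_mem.1 hd
  obtain ⟨j, hj, hF⟩ := mem_eval_fcard_zero.1 hx
  obtain ⟨j', hj', ha⟩ := ha
  obtain rfl := Part.mem_unique hj hj'
  exact hF.exists_of_le ha.le

theorem den_subtree {φ : Interp S} {n : ℕ} {I : Index S (n + 1)} {ρ : Fin n → ℕ} {a b y : ℕ}
    (h : Forest (fun v => I.eval φ (Fin.cons v ρ)) (b + 1) a y) (σ : ModTy S (n + 2)) :
    ((σ.inst .zero).subst (subtreeSubst I)).den φ (Fin.cons a (Fin.cons b ρ)) =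
      σ.den φ (Fin.cons 0 (Fin.cons (y + b + 1) ρ)) :=
  (ModTy.den_subst _ (transforms_subtree h)).trans (ModTy.den_inst_zero _ _)

theorem den_tree {φ : Interp S} {n : ℕ} {I : Index S (n + 1)} {ρ : Fin n → ℕ} {a y : ℕ}
    (h : Forest (fun v => I.eval φ (Fin.cons v ρ)) 0 a y) (σ : ModTy S (n + 2)) :
    ((σ.inst .zero).subst (treeSubst I)).den φ (Fin.cons a ρ) =
      σ.den φ (Fin.cons 0 (Fin.cons y ρ)) :=
  (ModTy.den_subst _ (transforms_tree h)).trans (ModTy.den_inst_zero _ _)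

/-- The ingredients `K`, `I`, `J`, `A`, `B` are uniformised and the forest cardinalities are formed
anew from them. The substituted node numbers have values where they are needed: below a finite `H`,
every list of siblings generates a finite subforest. -/
theorem uniformisable_fix (hE : E.Universal) {k : ℕ} {t : Term (k + 1)}
    (ih : Uniformisable E t) : Uniformisable E t.fix := by
  refine Uniformisable.of_proper fun {p} F {Φ' Γ' K' τ'} hp T => ?_
  choose Γ K I J A B d hAB hsum hW hτ hd hs hc using fun n => (hp n).inv_fix (F.wellDefined n)
  have hj n := (F.wellDefined n).judgDef
  let F₁ : Family E (p + 1) t := ⟨_, _, J, _, d, hd,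
    (computable_field 2 F.computable).of_eq fun n => (hc n).symm,
    fun m n => (Skeleton.fix.inj ((hs m).symm.trans ((F.skeleton_eq m n).trans (hs n)))).2⟩
  have hty := computable_type_code F.computable
  have hty₁ := computable_type_code F₁.computable
  -- `I` and `A` are read off the type of the recursive variable in the context of the premise. `B`
  -- is read off the type of the premise, since the conclusion contains it only after substitution.
  have hctx : Computable fun n => (ModTy.modal (I n) (A n)).code :=
    computable_code_of_entry (γ := fun n => F₁.Γ n 0) (fun n => rfl)
      (computable_entryCode F₁.computable 0)
  have heB n : (B n).dom.erase = (B 0).dom.erase ∧ (B n).cod.erase = (B 0).cod.erase := by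
    simpa [F₁, ModTy.modal, ModTy.erase] using F₁.erase_eq n 0
  have heA n : (A n).dom.erase = (B 0).dom.erase ∧ (A n).cod.erase = (B 0).cod.erase := by
    have h₁ := (hAB n).1.erase_eq
    have h₂ := (hAB n).2.erase_eq
    simp only [LinTy.subst, LinTy.inst, ModTy.erase_subst] at h₁ h₂
    exact ⟨h₁.trans (heB n).1, h₂.symm.trans (heB n).2⟩
  obtain ⟨L, hL⟩ := hE.exists_index (I := K) ((computable_field 1 hty).of_eq fun n => by
    simp [hτ n, ModTy.modal, ModTy.code, field_codeNode])
  obtain ⟨I', hI⟩ := hE.exists_index (I := I) ((computable_field 1 hctx).of_eq fun n => by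
    simp [ModTy.modal, ModTy.code, field_codeNode])
  obtain ⟨J', hJ⟩ := hE.exists_index (I := J) (computable_weight_code F₁.computable)
  obtain ⟨A₁, heA₁, hA₁⟩ := hE.exists_type (σ := fun n => (A n).dom)
    ((computable_field 2 hctx).of_eq fun n => by
      simp [ModTy.modal, ModTy.code, field_codeNode]) fun n => (heA n).1
  obtain ⟨A₂, heA₂, hA₂⟩ := hE.exists_type (σ := fun n => (A n).cod)
    ((computable_field 3 hctx).of_eq fun n => by
      simp [ModTy.modal, ModTy.code, field_codeNode]) fun n => (heA n).2
  obtain ⟨B₁, heB₁, hB₁⟩ := hE.exists_type (σ := fun n => (B n).dom)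
    ((computable_field 2 hty₁).of_eq fun n => by
      simp [F₁, ModTy.modal, ModTy.code, field_codeNode]) fun n => (heB n).1
  obtain ⟨B₂, heB₂, hB₂⟩ := hE.exists_type (σ := fun n => (B n).cod)
    ((computable_field 3 hty₁).of_eq fun n => by
      simp [F₁, ModTy.modal, ModTy.code, field_codeNode]) fun n => (heB n).2
  have hH : Uniform E (.fcard .zero L I') fun n => .fcard .zero (K n) (I n) := fun ρ n => by
    simp only [Index.eval, hL ρ n, cons_push, hI _ n]
  have hHd n : DlPCF.Def E (F.Φ n) (.fcard .zero (K n) (I n)) := def_iff.2 fun ρ hρ => by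
    have := def_iff.1 (hj n).2.1 ρ hρ
    rw [hW n] at this
    obtain ⟨z, hz⟩ := Part.dom_iff_mem.1 this
    obtain ⟨x, hx, -⟩ := mem_eval_add.1 hz
    exact Part.dom_iff_mem.2 ⟨x, hx⟩
  have hId := T.implies.def hH hHd
  have hforest (ρ : Fin p → ℕ) (n : ℕ) :
      (fun v => I'.eval E.interp (Fin.cons v (push ρ n))) =
        fun v => (I n).eval E.interp (Fin.cons v ρ) :=
    funext fun v => by rw [cons_push, hI]
  have hmodal : (ModTy.modal I' ⟨A₁, A₂⟩).Def E (Φ'.below (.fcard .zero L I')) :=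
    (T.implies.below hH).ty_def (σ := fun n => .modal (I n) (A n))
      (fun ρ n _ _ => by simp only [ModTy.modal, ModTy.den, hI ρ n, cons_push, hA₁, hA₂])
      fun n => (hd n).judgDef.1 0 _ rfl
  have hAB' : SubLin E ((Φ'.below (.fcard .zero L I')).below I')
      (((⟨B₁, B₂⟩ : LinTy S (p + 1 + 2)).inst .zero).subst (subtreeSubst I')) ⟨A₁, A₂⟩ := by
    have key (ρ) (hρ : Holds E ((Φ'.below (.fcard .zero L I')).below I') ρ) :
        ESub (A₁.den E.interp ρ) (((B₁.inst .zero).subst (subtreeSubst I')).den E.interp ρ) ∧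
        ESub (((B₂.inst .zero).subst (subtreeSubst I')).den E.interp ρ)
          (A₂.den E.interp ρ) := by
      induction ρ using Fin.consCases with | _ a ρ =>
      induction ρ using Fin.consCases with | _ b ρ =>
      obtain ⟨ρ, n, rfl⟩ := exists_push ρ
      obtain ⟨ha, hρ⟩ := holds_below.1 hρ
      obtain ⟨hb, hρ⟩ := holds_below.1 hρ
      -- With `y` nodes in the subtrees of the first `a` children of `b`, the next child has number
      -- `y + b + 1`. The same forest serves the uniform terms and the `n`-th member, so the side
      -- condition is inherited from the latter.
      obtain ⟨y, hy'⟩ := exists_children hb ha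
      have hy := hforest ρ n ▸ hy'
      rw [hH] at hb
      rw [cons_push, hI] at ha
      have hρn := holds_below.2 ⟨ha, holds_below.2 ⟨hb, T.implies ρ n hρ⟩⟩
      have h₁ := (hAB n).1.den hρn
      have h₂ := (hAB n).2.den hρn
      simp only [LinTy.subst, LinTy.inst] at h₁ h₂
      have hs₁ := den_subtree hy (B n).dom
      have hs₂ := den_subtree hy (B n).cod
      simp only [ModTy.inst] at hs₁ hs₂
      rw [hs₁] at h₁
      rw [hs₂] at h₂
      rw [den_subtree hy', den_subtree hy']
      simp only [cons_push, hA₁, hA₂, hB₁, hB₂]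
      exact ⟨h₁, h₂⟩
    refine ⟨.of_den ?_ fun ρ hρ => (key ρ hρ).1, .of_den ?_ fun ρ hρ => (key ρ hρ).2⟩
    · simp only [LinTy.subst, LinTy.inst, ModTy.erase_subst, heA₁, heB₁]
    · simp only [LinTy.subst, LinTy.inst, ModTy.erase_subst, heA₂, heB₂]
  obtain ⟨Γ'', Δ'', hsum'', hsub, hΔd, hΓd, hlow⟩ := hE.exists_ctx_bsum T.implies hH hId hsum
    (fun x => (computable_entryCode F₁.computable x.succ).of_eq fun n => by
      simp [F₁, Ctx.snoc])
    (computable_entryCode F.computable) (fun n => (hj n).1) T.ctx T.ctx_def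
  refine T.derivable (K'' := .add (.fcard .zero L I') (.bsum (.fcard .zero L I') J'))
    (τ'' := .modal L (((⟨B₁, B₂⟩ : LinTy S (p + 1 + 2)).inst .zero).subst (treeSubst I'))) hsub
    (fun ρ n _ => ?_) (fun n => ?_) (fun ρ n hd hρ => ?_) fun hKd hτd => ?_
  · exact hW n ▸ (hH.add (hH.bsum hJ)) ρ n
  · simp only [hτ, ModTy.modal, LinTy.subst, LinTy.inst, ModTy.erase, ModTy.erase_subst, heB₁,
      heB₂, heB n]
  · rw [hτ] at hd ⊢
    refine ESub.of_eqOn (hL ρ n) (fun a ha => ?_) hd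
    obtain ⟨y, hy⟩ := exists_trees (def_iff.1 (hHd n) ρ (T.implies ρ n hρ)) ha
    have hy' := (hforest ρ n).symm ▸ hy
    have e₁ := den_tree hy (B n).dom
    have e₂ := den_tree hy (B n).cod
    have e₁' := den_tree hy' B₁
    have e₂' := den_tree hy' B₂
    simp only [ModTy.inst] at e₁ e₂ e₁' e₂'
    simp only [LinTy.subst, LinTy.inst, e₁, e₂, e₁', e₂']
    simp only [cons_push, hB₁, hB₂, and_self]
  · obtain ⟨D, hD⟩ := ih F₁ (F₁.target (τ' := .modal .one ⟨B₁, B₂⟩) (T.implies.below hH)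
      (hlow.snoc (σ := fun n => .modal (I n) (A n)) fun n => .of_eq hmodal
        (by simp only [ModTy.modal, ModTy.erase, heA₁, heA₂, heA n])
        fun ρ => by simp only [ModTy.modal, ModTy.den, hI ρ n, cons_push, hA₁, hA₂])
      (hΓd.snoc hmodal) hJ
      (fun n => by simp only [F₁, ModTy.modal, ModTy.erase, heB₁, heB₂, heB n])
      fun ρ n => by
        simp only [F₁, ModTy.modal, ModTy.den, cons_push, hB₁, hB₂, Index.eval])
    exact ⟨.fix rfl D hAB' hsum'', ⟨hΔd, hKd, hτd⟩, hD⟩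

theorem uniformisable (hE : E.Universal) {k : ℕ} (t : Term k) : Uniformisable E t := by
  induction t with
  | var x => exact uniformisable_var x
  | num m => exact uniformisable_num m
  | lam t ih => exact uniformisable_lam hE ih
  | fix t ih => exact uniformisable_fix hE ih
  | app t u iht ihu => exact uniformisable_app hE iht ihu
  | succ t ih => exact uniformisable_succ hE ih
  | pred t ih => exact uniformisable_pred hE ih
  | ifz t u s iht ihu ihs => exact uniformisable_ifz hE iht ihu ihs

end DlPCF

/-- The judgement with uniformised weight and type in the empty context is weaker than all members
of the family, hence derivable. Instantiating its variable by a numeral gives back the values of the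
`n`-th judgement, and their definedness turns equality of values into the two inequalities and
subtypings. -/
theorem mainTheorem7 {S : DlPCF.Signature.{u}} (E : DlPCF.EqProgram S) (hE : E.Universal)
    (t : DlPCF.Term 0) (I : ℕ → DlPCF.Index S 0) (σ : ℕ → DlPCF.ModTy S 0)
    (D : ∀ n : ℕ, DlPCF.Deriv E [] DlPCF.Ctx.empty (I n) t (σ n))
    (hdef : ∀ n : ℕ, (D n).WellDefined)
    (hre : Computable fun n : ℕ => (D n).code)
    (hskel : ∀ m n : ℕ, (D m).skeleton = (D n).skeleton) :
    ∃ (J : DlPCF.Index S 1) (τ : DlPCF.ModTy S 1)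
      (D' : DlPCF.Deriv E [] DlPCF.Ctx.empty J t τ),
      D'.WellDefined ∧
      ∀ n : ℕ, DlPCF.Eqv E [] (J.inst (.numeral n)) (I n) ∧
        DlPCF.TyEqv E [] (τ.inst (.numeral n)) (σ n) := by
  open DlPCF in
  let F : Family E 0 t := ⟨_, _, I, σ, D, hdef, hre, hskel⟩
  obtain ⟨J, hJ⟩ := hE.exists_index (computable_weight_code hre)
  obtain ⟨τ, hτe, hτ⟩ := hE.exists_type (computable_type_code hre) fun n => F.erase_eq n 0
  obtain ⟨D', hD'⟩ := uniformisable hE t F (F.target (Φ' := []) (Γ' := Ctx.empty)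
    (fun ρ n _ => holds_nil ρ) (fun x => x.elim0) (fun x => x.elim0) hJ
    (fun n => hτe.trans (F.erase_eq 0 n)) hτ)
  refine ⟨J, τ, D', hD', fun n => ?_⟩
  -- With no other index variables, the last variable is also variable `0`, the one that `inst`
  -- replaces.
  have hcons (ρ : Fin 0 → ℕ) : (Fin.cons n ρ : Fin 1 → ℕ) = push ρ n :=
    funext (Fin.cases rfl fun i => i.elim0)
  have htr (ρ : Fin 0 → ℕ) : Transforms E.interp (Index.single (.numeral n)) ρ (push ρ n) :=
    hcons ρ ▸ transforms_single (Index.eval_numeral _ n ρ)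
  have hJn (ρ) : (J.inst (.numeral n)).eval E.interp ρ = (I n).eval E.interp ρ :=
    (J.eval_subst (htr ρ)).trans (hJ ρ n)
  have hτn (ρ) : (τ.inst (.numeral n)).den E.interp ρ = (σ n).den E.interp ρ :=
    (τ.den_subst (htr ρ)).trans (hτ ρ n)
  have he : (τ.inst (.numeral n)).erase = (σ n).erase :=
    (ModTy.erase_inst _ _).trans (hτe.trans (F.erase_eq 0 n))
  obtain ⟨-, hId, hσd⟩ := (hdef n).judgDef
  have hIle (ρ : Fin 0 → ℕ) : PLe ((I n).eval E.interp ρ) ((I n).eval E.interp ρ) :=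
    .refl (def_iff.1 hId ρ (holds_nil ρ))
  have hσle (ρ : Fin 0 → ℕ) := ESub.refl (ModTy.def_iff.1 hσd ρ (holds_nil ρ))
  refine ⟨⟨fun ρ _ => ?_, fun ρ _ => ?_⟩, .of_den he fun ρ _ => ?_, .of_den he.symm fun ρ _ => ?_⟩
  · change PLe _ _
    rw [hJn]
    exact hIle ρ
  · change PLe _ _
    rw [hJn]
    exact hIle ρ
  · rw [hτn]
    exact hσle ρ
  · rw [hτn]
    exact hσle ρ
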